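/- **Setting.** Let $r\ge 0$, let $U\subseteq\mathbb R^m$ be closed and convex with $0\in U$, let $\Pr_U$ be the projection onto $U$, and let $f:\mathbb R^n\times U\to\mathbb R^n$ be locally Lipschitz. Norms $|\cdot|$ are Euclidean, and $\|\varphi\|_r=\sup_{\theta\in[-r,0]}|\varphi(\theta)|$. Write $T_r(t)u\in C^0([-r,0])$ for the history $\theta\mapsto u(t+\theta)$. A function $\sigma:[0,\infty)^2\to[0,\infty)$ is of class $KL$ if it is continuous, $\sigma(0,t)=0$, $s\mapsto\sigma(s,t)$ is strictly increasing for each $t$, and $t\mapsto\sigma(s,t)$ is nonincreasing with limit $0$ as $t\to\infty$ for each $s$. Assume that there is $L\ge 0$ with $$|f(x,u)-f(y,u)|\le L|x-y|,\qquad |f(x,u)|\le L|x|+L|u|\qquad(x,y\in\mathbb R^n,\ u\in U).$$ Let $k\in C^1(\mathbb R^n;U)$ with $k(0)=0$ and $|\nabla k(x)|\le R$ for all $x\in\mathbb R^n$, where $R\ge 0$. Consider the following stability properties of $\dot x=f(x,\Pr_U(k(x)+v))$, required for all $x(0)=x_0\in\mathbb R^n$, all measurable locally essentially bounded $v:[0,\infty)\to\mathbb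 R^m$ and all $t\ge 0$: - (ISS) for some $\sigma\in KL$ and $\gamma\ge 0$: $\ |x(t)|\le\max\{\sigma(|x_0|,t),\ \gamma\sup_{0\le\tau\le t}|v(\tau)|\}$; - (expISS) for some $M,\omega>0$ and $\gamma\ge0$: $\ |x(t)|\le\max\{Me^{-\omega t}|x_0|,\ \gamma\sup_{0\le\tau\le t}e^{-\omega(t-\tau)}|v(\tau)|\}$. **Approximate predictor.** Let $q\ge 1$ be an integer with $Lr<q$, and put $T=r/q$. For an input $u$ on $[0,T]$ and $x\in C^0([0,T];\mathbb R^n)$ let $(P_{T,u}x)(t)=x(0)+\int_0^t f(x(\tau),u(\tau))\,d\tau$. For $x\in\mathbb R^n$ and an integer $l\ge1$ let $Q^l_{T,u}x=(P^l_{T,u}\mathbf{x})(T)$, where $\mathbf{x}$ is the constant function with value $x$. For an input $u$ on $[0,r]$ let $P^u_{l,q}x=Q^l_{T,u_q}\cdots Q^l_{T,u_1}x$ with $u_i(s)=u(s+(i-1)T)$. For $(x,u)\in\mathbb R^n\times C^0([-r,0];U)$ let $$p_{l,q}(x,u)=k\bigl(P^{\delta_{-r}u}_{l,q}x\bigr),\qquad(\delta_{-r}u)(s)=u(s-r).$$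 A map on $\mathbb R^n\times C^0([-r,0];U)$ is called completely Lipschitz if it is Lipschitz on every bounded subset. Call $g_{l,q}:\mathbb R^n\times C^0([-r,0];U)\to\mathbb R^m$ a *derivative map* for $p_{l,q}$ if $g_{l,q}$ is completely Lipschitz, $|g_{l,q}(x,u)|\le G|x|+G\|u\|_r$ on its domain for some $G\ge0$, and for every $u\in C^0([-r,\infty);U)$ and every solution of $\dot x(t)=f(x(t),u(t-r))$ on $[0,\infty)$ one has $\frac{d}{dt}p_{l,q}(x(t),T_r(t)u)=g_{l,q}(x(t),T_r(t)u)$ for all $t\ge 0$ (one-sided derivative at $t=0$). **Corollary 3.4.** For $\mu>0$ consider the closed loop $$\dot x(t)=f(x(t),u(t-r)),\quad u(t)=\Pr\nolimits_U(w(t)),\quad \dot w(t)=g_{l,q}(x(t),T_r(t)u)-\mu\bigl(w(t)-p_{l,q}(x(t),T_r(t)u)\bigr),$$ with $x(0)=x_0\in\mathbb R^n$ and $T_r(0)w=w_0\in C^0([-r,0];\mathbb R^m)$. 1. If (ISS) holds, there is $l_0\ge1$ such that for every $l\ge l_0$ for which $p_{l,q}$ is completely Lipschitz, every derivative map $g_{l,q}$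 for $p_{l,q}$ and every $\mu>0$, there is $\tilde\sigma\in KL$ such that, for every $(x_0,w_0)$, the closed loop has a unique solution, this solution exists for all $t\ge0$, and $$|x(t)|+|w(t)|\le\tilde\sigma(|x_0|+\|w_0\|_r,\,t)\qquad\text{for all }t\ge0.$$ 2. If (expISS) holds, there is $l_0\ge1$ such that for every $l\ge l_0$ for which $p_{l,q}$ is completely Lipschitz, every derivative map $g_{l,q}$ for $p_{l,q}$ and every $\mu>0$, there are $\tilde M,\tilde\omega>0$ such that, for every $(x_0,w_0)$, the closed loop has a unique solution, this solution exists for all $t\ge0$, and $$|x(t)|+|w(t)|\le\tilde M e^{-\tilde\omega t}\bigl(|x_0|+\|w_0\|_r\bigr)\qquad\text{for all }t\ge0.$$ -/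

import Mathlib

open MeasureTheory Set Filter Topology

namespace ApproxPredictor

/-- Euclidean space `ℝⁿ` with the Euclidean norm. -/
abbrev Vec (n : ℕ) := EuclideanSpace ℝ (Fin n)

/-- `C⁰([-r,0]; ℝᵐ)`; its norm is `‖φ‖_r = sup_{θ ∈ [-r,0]} |φ θ|`. -/
abbrev Hist (r : ℝ) (m : ℕ) := C(Icc (-r) (0 : ℝ), Vec m)

/-- Class `KL`: a jointly continuous function `[0,∞) × [0,∞) → [0,∞)` which, for each fixed `t`, is
zero at zero and strictly increasing in `s`, and, for each fixed `s`, is nonincreasing in `t` with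
limit `0` as `t → ∞`. (Nonnegativity follows.) -/
structure IsKL (σ : ℝ → ℝ → ℝ) : Prop where
  continuousOn : ContinuousOn (fun z : ℝ × ℝ => σ z.1 z.2) (Ici 0 ×ˢ Ici 0)
  zero : ∀ t, 0 ≤ t → σ 0 t = 0
  strictMonoOn : ∀ t, 0 ≤ t → StrictMonoOn (fun s => σ s t) (Ici 0)
  antitoneOn : ∀ s, 0 ≤ s → AntitoneOn (fun t => σ s t) (Ici 0)
  tendsto : ∀ s, 0 ≤ s → Tendsto (fun t => σ s t) atTop (𝓝 0)

/-- The projection `Pr_U w`: the point of `U` nearest to `w` (it exists and is unique for a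
nonempty closed convex set `U`). -/
noncomputable def proj {m : ℕ} (U : Set (Vec m)) (w : Vec m) : Vec m :=
  Classical.epsilon fun v => v ∈ U ∧ ∀ z ∈ U, ‖w - v‖ ≤ ‖w - z‖

theorem proj_spec {m : ℕ} {U : Set (Vec m)} (hU : IsClosed U) (h0 : (0 : Vec m) ∈ U) (w : Vec m) :
    proj U w ∈ U ∧ ∀ z ∈ U, ‖w - proj U w‖ ≤ ‖w - z‖ := by
  refine Classical.epsilon_spec (p := fun v => v ∈ U ∧ ∀ z ∈ U, ‖w - v‖ ≤ ‖w - z‖) ?_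
  obtain ⟨v, hv, h⟩ := hU.exists_infDist_eq_dist ⟨0, h0⟩ w
  refine ⟨v, hv, fun z hz => ?_⟩
  rw [← dist_eq_norm, ← dist_eq_norm, ← h]
  exact Metric.infDist_le_dist_of_mem hz

open Classical in
/-- The history `T_r(t)u = {u(t+θ) : θ ∈ [-r,0]}` as an element of `C⁰([-r,0]; ℝᵐ)`, for `u`
continuous on `[t-r,t]` (and `0` by convention otherwise). -/
noncomputable def history {m : ℕ} (r : ℝ) (u : ℝ → Vec m) (t : ℝ) : Hist r m :=
  if h : Continuous (fun θ : Icc (-r) (0 : ℝ) => u (t + θ)) then ⟨_, h⟩ else 0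

theorem history_apply {m : ℕ} {r : ℝ} {u : ℝ → Vec m} {t : ℝ}
    (h : ContinuousOn u (Icc (t - r) t)) (θ : Icc (-r) (0 : ℝ)) :
    history r u t θ = u (t + θ) := by
  have hc : Continuous (fun θ : Icc (-r) (0 : ℝ) => u (t + θ)) := by
    refine h.comp_continuous (by fun_prop) fun θ => ?_
    have h1 := θ.2.1
    have h2 := θ.2.2
    constructor <;> linarith
  simp [history, hc]

open Classical in
/-- The shifted input `(δ_{-r}φ)(s) = φ(s - r)`, `s ∈ [0,r]` (extended by `0`). -/
noncomputable def delayShift {m : ℕ} {r : ℝ} (φ : Hist r m) (s : ℝ) : Vec m :=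
  if h : s - r ∈ Icc (-r) (0 : ℝ) then φ ⟨s - r, h⟩ else 0

/-- The successive approximation operator
`(P_{T,u} x)(t) = x(0) + ∫₀ᵗ f(x(τ), u(τ)) dτ`; only the values on `[0,T]` will be used. -/
noncomputable def picard {n m : ℕ} (f : Vec n → Vec m → Vec n) (u : ℝ → Vec m)
    (x : ℝ → Vec n) : ℝ → Vec n :=
  fun t => x 0 + ∫ τ in (0 : ℝ)..t, f (x τ) (u τ)

/-- `Q^l_{T,u} x`: apply `P_{T,u}` `l` times to the constant function `x` and evaluate at `T`. -/
noncomputable def stepApprox {n m : ℕ} (f : Vec n → Vec m → Vec n) (T : ℝ) (l : ℕ)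
    (u : ℝ → Vec m) (x : Vec n) : Vec n :=
  (picard f u)^[l] (fun _ => x) T

/-- `Q^l_{T,u_i} ⋯ Q^l_{T,u_1} x`, where `u_j(s) = u(s + (j-1)T)`. -/
noncomputable def composeApprox {n m : ℕ} (f : Vec n → Vec m → Vec n) (T : ℝ) (l : ℕ)
    (u : ℝ → Vec m) (x : Vec n) : ℕ → Vec n
  | 0 => x
  | i + 1 => stepApprox f T l (fun s => u (s + i * T)) (composeApprox f T l u x i)

/-- `P^u_{l,q} x = Q^l_{T,u_q} ⋯ Q^l_{T,u_1} x` with `T = r / q`. -/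
noncomputable def flowApprox {n m : ℕ} (f : Vec n → Vec m → Vec n) (r : ℝ) (l q : ℕ)
    (u : ℝ → Vec m) (x : Vec n) : Vec n :=
  composeApprox f (r / q) l u x q

/-- The approximate predictor `p_{l,q}(x,φ) = k(P^{δ_{-r}φ}_{l,q} x)`. -/
noncomputable def predictor {n m : ℕ} (f : Vec n → Vec m → Vec n) (k : Vec n → Vec m) (r : ℝ)
    (l q : ℕ) (x : Vec n) (φ : Hist r m) : Vec m :=
  k (flowApprox f r l q (delayShift φ) x)

/-- `F : ℝⁿ × C⁰([-r,0]; U) → ℝᵐ` is completely Lipschitz: it is Lipschitz on each bounded subset of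
its domain. Values of `F` at histories which are not `U`-valued play no role. -/
def CompletelyLipschitz {n m : ℕ} (U : Set (Vec m)) (r : ℝ) (F : Vec n → Hist r m → Vec m) :
    Prop :=
  ∀ S : Set (Vec n × Hist r m), Bornology.IsBounded S → (∀ z ∈ S, ∀ θ, z.2 θ ∈ U) →
    ∃ C : ℝ, 0 ≤ C ∧ ∀ z ∈ S, ∀ z' ∈ S,
      ‖F z.1 z.2 - F z'.1 z'.2‖ ≤ C * ‖z.1 - z'.1‖ + C * ‖z.2 - z'.2‖

/-- `x` solves the input-delay system `x'(t) = f(x(t), u(t-r))` on the interval `I`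
(one-sided derivative at an end point belonging to `I`). -/
def IsDelaySolution {n m : ℕ} (f : Vec n → Vec m → Vec n) (r : ℝ) (I : Set ℝ) (u : ℝ → Vec m)
    (x : ℝ → Vec n) : Prop :=
  ∀ t ∈ I, HasDerivWithinAt x (f (x t) (u (t - r))) I t

/-- `v` is (Lebesgue) measurable and locally essentially bounded on `[0,∞)`. -/
def IsInput {m : ℕ} (v : ℝ → Vec m) : Prop :=
  AEMeasurable v (volume.restrict (Ici 0)) ∧
    ∀ T : ℝ, ∃ C : ℝ, ∀ᵐ τ ∂(volume.restrict (Icc 0 T)), ‖v τ‖ ≤ C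

/-- `x` is the (Carathéodory) solution on `[0,∞)` of the delay-free system `x' = f(x,u)` with
`u = Pr_U(k(x) + v)`. -/
def IsPerturbedSolution {n m : ℕ} (U : Set (Vec m)) (f : Vec n → Vec m → Vec n)
    (k : Vec n → Vec m) (v : ℝ → Vec m) (x : ℝ → Vec n) : Prop :=
  ContinuousOn x (Ici 0) ∧
    ∀ t, 0 ≤ t → x t = x 0 + ∫ s in (0 : ℝ)..t, f (x s) (proj U (k (x s) + v s))

/-- Input-to-state stability with linear gain:
`|x(t)| ≤ max {σ(|x₀|,t), γ sup_{0≤τ≤t} |v(τ)|}` for all `x₀`, `v`, `t ≥ 0`. The supremum is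
expressed through its upper bounds `b`. -/
def LinearGainISS {n m : ℕ} (U : Set (Vec m)) (f : Vec n → Vec m → Vec n) (k : Vec n → Vec m)
    (σ : ℝ → ℝ → ℝ) (γ : ℝ) : Prop :=
  ∀ (v : ℝ → Vec m) (x : ℝ → Vec n), IsInput v → IsPerturbedSolution U f k v x →
    ∀ t, 0 ≤ t → ∀ b : ℝ, (∀ τ ∈ Icc 0 t, ‖v τ‖ ≤ b) →
      ‖x t‖ ≤ max (σ ‖x 0‖ t) (γ * b)

/-- Exponential input-to-state stability:
`|x(t)| ≤ max {M e^{-ωt}|x₀|, γ sup_{0≤τ≤t} e^{-ω(t-τ)}|v(τ)|}` for all `x₀`, `v`, `t ≥ 0`. -/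
def ExpISS {n m : ℕ} (U : Set (Vec m)) (f : Vec n → Vec m → Vec n) (k : Vec n → Vec m)
    (M ω γ : ℝ) : Prop :=
  ∀ (v : ℝ → Vec m) (x : ℝ → Vec n), IsInput v → IsPerturbedSolution U f k v x →
    ∀ t, 0 ≤ t → ∀ b : ℝ, (∀ τ ∈ Icc 0 t, Real.exp (-ω * (t - τ)) * ‖v τ‖ ≤ b) →
      ‖x t‖ ≤ max (M * Real.exp (-ω * t) * ‖x 0‖) (γ * b)

/-- The requirements on a predictor `p` and its derivative map `g`: both are completely Lipschitz,
`|g(x,φ)| ≤ G|x| + G‖φ‖_r`, and `d/dt p(x(t),T_r(t)u) = g(x(t),T_r(t)u)` for all `t ≥ 0` along every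
solution of `x'(t) = f(x(t),u(t-r))` with continuous `u : [-r,∞) → U`. -/
structure IsDerivativePair {n m : ℕ} (U : Set (Vec m)) (f : Vec n → Vec m → Vec n) (r : ℝ)
    (p g : Vec n → Hist r m → Vec m) : Prop where
  lipschitz_p : CompletelyLipschitz U r p
  lipschitz_g : CompletelyLipschitz U r g
  growth : ∃ G : ℝ, 0 ≤ G ∧ ∀ (x : Vec n) (φ : Hist r m), (∀ θ, φ θ ∈ U) →
    ‖g x φ‖ ≤ G * ‖x‖ + G * ‖φ‖
  deriv : ∀ (u : ℝ → Vec m) (x : ℝ → Vec n), ContinuousOn u (Ici (-r)) →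
    (∀ t, -r ≤ t → u t ∈ U) → IsDelaySolution f r (Ici 0) u x →
    ∀ t, 0 ≤ t → HasDerivWithinAt (fun s => p (x s) (history r u s)) (g (x t) (history r u t))
      (Ici 0) t

/-- `(x,w)` solves on `I` (an interval `[0,a)` or `[0,∞)`) the closed loop
`x'(t) = f(x(t),u(t-r))`, `u(t) = Pr_U(w(t))`,
`w'(t) = g(x(t),T_r(t)u) - μ(w(t) - p(x(t),T_r(t)u))` with `x(0) = x₀`, `T_r(0)w = w₀`. -/
structure IsClosedLoopSolution {n m : ℕ} (U : Set (Vec m)) (f : Vec n → Vec m → Vec n) (r : ℝ)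
    (p g : Vec n → Hist r m → Vec m) (μ : ℝ) (x₀ : Vec n) (w₀ : Hist r m) (I : Set ℝ)
    (x : ℝ → Vec n) (w : ℝ → Vec m) : Prop where
  continuousOn : ContinuousOn w (Icc (-r) 0 ∪ I)
  initial_x : x 0 = x₀
  initial_w : ∀ θ : Icc (-r) (0 : ℝ), w θ = w₀ θ
  eq_x : IsDelaySolution f r I (fun s => proj U (w s)) x
  eq_w : ∀ t ∈ I, HasDerivWithinAt w
    (g (x t) (history r (fun s => proj U (w s)) t) -
      μ • (w t - p (x t) (history r (fun s => proj U (w s)) t))) I t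

/-- From every initial condition the closed loop has a solution on `[0,∞)`, every solution on an
interval `[0,a)` is a restriction of it, and it satisfies `|x(t)| + |w(t)| ≤ β(|x₀| + ‖w₀‖_r, t)` for
all `t ≥ 0`. -/
def ClosedLoopEstimate {n m : ℕ} (U : Set (Vec m)) (f : Vec n → Vec m → Vec n) (r : ℝ)
    (p g : Vec n → Hist r m → Vec m) (μ : ℝ) (β : ℝ → ℝ → ℝ) : Prop :=
  ∀ (x₀ : Vec n) (w₀ : Hist r m), ∃ (x : ℝ → Vec n) (w : ℝ → Vec m),
    IsClosedLoopSolution U f r p g μ x₀ w₀ (Ici 0) x w ∧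
    (∀ a : ℝ, 0 < a → ∀ (y : ℝ → Vec n) (z : ℝ → Vec m),
      IsClosedLoopSolution U f r p g μ x₀ w₀ (Ico 0 a) y z →
        EqOn y x (Ico 0 a) ∧ EqOn z w (Ico 0 a)) ∧
    ∀ t, 0 ≤ t → ‖x t‖ + ‖w t‖ ≤ β (‖x₀‖ + ‖w₀‖) t

end ApproxPredictor

open ApproxPredictor

/-! Put `v t = w t - k (x (t + r))`. Since `Pr_U (w t) = Pr_U (k (x (t + r)) + v t)`, the advanced
state `z t = x (t + r)` solves the delay-free system with perturbation `v`, and the assumed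
stability bounds `z` by `v`. Conversely, `v` is small compared to `z`. The feedforward term `g`
cancels the derivative of the predictor `p` along the solution, so `w - p` satisfies `e' = -μ e` and
decays exponentially. What remains, `p - k (x (t + r))`, is at most `R` times the prediction error.
Each of the `q` prediction steps is a Picard iteration with contraction factor `L T < 1`, so this
error is at most `ε l` times the supremum of `‖x‖` over `[t, t + r]`, with `ε l → 0`
(`norm_flowApprox_sub_le`). Together these facts form `LoopBounds`.

For large `l` the loop gain is small and a small-gain argument closes the loop. With exponential
weights, `weighted_small_gain` gives exponential decay under (expISS); with weight one it gives
uniform boundedness under (ISS). In the latter case, restarting the ISS estimate at later times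
halves the bound again and again (`uniform_decay`), at times which depend only on the size of the
initial data. Uniform boundedness and uniform attractivity are then turned into a single `KL` bound
by `exists_isKL_majorant`.

Existence and uniqueness come from rewriting the closed loop as a causal functional differential
equation of linear growth (`IsVolterra`), solved by a contraction in an exponentially weighted norm.
-/

namespace ApproxPredictor

/-! ### Nonexpansiveness of the projection onto `U` -/

section Projection

variable {m : ℕ} {U : Set (Vec m)}

/-- The variational inequality characterising each projection is tested with the other projected
point. Adding the two inequalities and applying Cauchy–Schwarz gives the claim. -/
theorem norm_proj_sub_proj_le (hU : IsClosed U) (hc : Convex ℝ U) (h0 : (0 : Vec m) ∈ U)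
    (a b : Vec m) : ‖proj U a - proj U b‖ ≤ ‖a - b‖ := by
  have key : ∀ w : Vec m, ∀ z ∈ U, inner ℝ (w - proj U w) (z - proj U w) ≤ 0 := by
    intro w
    obtain ⟨hw, hmin⟩ := proj_spec hU h0 w
    refine (norm_eq_iInf_iff_real_inner_le_zero hc hw).1 (le_antisymm ?_ ?_)
    · have : Nonempty U := ⟨⟨0, h0⟩⟩
      exact le_ciInf fun z => hmin z z.2
    · exact ciInf_le ⟨0, fun _ ⟨_, h⟩ => h ▸ norm_nonneg _⟩ (⟨proj U w, hw⟩ : U)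
  have h1 := key a _ (proj_spec hU h0 b).1
  have h2 := key b _ (proj_spec hU h0 a).1
  have h3 : ‖proj U a - proj U b‖ * ‖proj U a - proj U b‖ ≤
      ‖a - b‖ * ‖proj U a - proj U b‖ := by
    refine le_trans ?_ (real_inner_le_norm (a - b) (proj U a - proj U b))
    rw [← real_inner_self_eq_norm_mul_norm]
    have e : inner ℝ (a - b) (proj U a - proj U b) -
        inner ℝ (proj U a - proj U b) (proj U a - proj U b) =
        - inner ℝ (a - proj U a) (proj U b - proj U a) -
          inner ℝ (b - proj U b) (proj U a - proj U b) := by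
      simp only [inner_sub_left, inner_sub_right]
      ring
    linarith
  rcases (norm_nonneg (proj U a - proj U b)).eq_or_lt with h | h
  · rw [← h]; exact norm_nonneg _
  · exact le_of_mul_le_mul_right h3 h

theorem proj_zero (hU : IsClosed U) (h0 : (0 : Vec m) ∈ U) : proj U (0 : Vec m) = 0 := by
  have := (proj_spec hU h0 0).2 0 h0
  simpa using this

theorem norm_proj_le (hU : IsClosed U) (hc : Convex ℝ U) (h0 : (0 : Vec m) ∈ U) (a : Vec m) :
    ‖proj U a‖ ≤ ‖a‖ := by
  simpa [proj_zero hU h0] using norm_proj_sub_proj_le hU hc h0 a 0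

theorem continuous_proj (hU : IsClosed U) (hc : Convex ℝ U) (h0 : (0 : Vec m) ∈ U) :
    Continuous (proj U) :=
  (LipschitzWith.of_dist_le_mul (K := 1) fun a b => by
    simpa [dist_eq_norm] using norm_proj_sub_proj_le hU hc h0 a b).continuous

end Projection

/-! ### Bounds and error estimates for the approximate predictor -/

section Picard

variable {n m : ℕ} {U : Set (Vec m)} {f : Vec n → Vec m → Vec n} {L : ℝ}

theorem continuousOn_rhs (hf : ContinuousOn (fun z : Vec n × Vec m => f z.1 z.2) (univ ×ˢ U))
    {s : Set ℝ} {x : ℝ → Vec n} {u : ℝ → Vec m} (hx : ContinuousOn x s) (hu : ContinuousOn u s)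
    (huU : ∀ t ∈ s, u t ∈ U) : ContinuousOn (fun t => f (x t) (u t)) s :=
  hf.comp (f := fun t => (x t, u t)) (hx.prodMk hu) fun t ht => ⟨mem_univ _, huU t ht⟩

theorem norm_integral_le_mul {E : Type*} [NormedAddCommGroup E] [NormedSpace ℝ E] {h : ℝ → E}
    {T t b : ℝ} (hb : 0 ≤ b) (ht : t ∈ Icc 0 T) (h' : ∀ s ∈ Icc 0 T, ‖h s‖ ≤ b) :
    ‖∫ τ in (0 : ℝ)..t, h τ‖ ≤ b * T := by
  have h1 : ‖∫ τ in (0 : ℝ)..t, h τ‖ ≤ b * |t - 0| := by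
    refine intervalIntegral.norm_integral_le_of_norm_le_const fun s hs => h' s ?_
    rw [uIoc_of_le ht.1] at hs
    exact ⟨hs.1.le, hs.2.trans ht.2⟩
  rw [sub_zero, abs_of_nonneg ht.1] at h1
  exact h1.trans (mul_le_mul_of_nonneg_left ht.2 hb)

theorem continuousOn_primitive_Icc {E : Type*} [NormedAddCommGroup E] [NormedSpace ℝ E]
    {h : ℝ → E} {T : ℝ} (hT : 0 ≤ T) (hh : ContinuousOn h (Icc 0 T)) :
    ContinuousOn (fun t => ∫ τ in (0 : ℝ)..t, h τ) (Icc 0 T) := by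
  have := intervalIntegral.continuousOn_primitive_interval (a := 0) (b := T) (f := h)
    (μ := volume) (by rw [uIcc_of_le hT]; exact hh.integrableOn_Icc)
  rwa [uIcc_of_le hT] at this

theorem intervalIntegrable_of_continuousOn_Icc {E : Type*} [NormedAddCommGroup E]
    [NormedSpace ℝ E] {h : ℝ → E} {T a b : ℝ} (hh : ContinuousOn h (Icc 0 T))
    (ha : a ∈ Icc 0 T) (hb : b ∈ Icc 0 T) : IntervalIntegrable h volume a b :=
  (hh.mono (uIcc_subset_Icc ha hb)).intervalIntegrable

theorem picard_iterate_zero (u : ℝ → Vec m) (x : Vec n) (l : ℕ) :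
    (picard f u)^[l] (fun _ => x) 0 = x := by
  induction l with
  | zero => rfl
  | succ l ih => rw [Function.iterate_succ_apply']; simp [picard, ih]

theorem continuousOn_picard_iterate
    (hf : ContinuousOn (fun z : Vec n × Vec m => f z.1 z.2) (univ ×ˢ U))
    {T : ℝ} (hT : 0 ≤ T) {u : ℝ → Vec m} (hu : ContinuousOn u (Icc 0 T))
    (huU : ∀ t ∈ Icc 0 T, u t ∈ U) (x : Vec n) (l : ℕ) :
    ContinuousOn ((picard f u)^[l] fun _ => x) (Icc 0 T) := by
  induction l with
  | zero => exact continuousOn_const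
  | succ l ih =>
    rw [Function.iterate_succ_apply']
    exact continuousOn_const.add
      (continuousOn_primitive_Icc hT (continuousOn_rhs hf ih hu huU))

/-- The radius `C` solves `C = L T C + (‖x‖ + b)`, so the ball of radius `C` is invariant under the
Picard operator. The bound is therefore uniform in `l`. -/
theorem norm_stepApprox_le (hL : 0 ≤ L)
    (hfGrowth : ∀ x : Vec n, ∀ u ∈ U, ‖f x u‖ ≤ L * ‖x‖ + L * ‖u‖)
    {T : ℝ} (hT : 0 ≤ T) (hLT : L * T < 1) {u : ℝ → Vec m} {b : ℝ} (hb : 0 ≤ b)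
    (huU : ∀ t ∈ Icc 0 T, u t ∈ U) (hub : ∀ t ∈ Icc 0 T, ‖u t‖ ≤ b) (x : Vec n) (l : ℕ) :
    ‖stepApprox f T l u x‖ ≤ (1 - L * T)⁻¹ * (‖x‖ + b) := by
  set C := (1 - L * T)⁻¹ * (‖x‖ + b) with hC
  have h1 : 0 < 1 - L * T := by linarith
  have hCe : C = L * T * C + (‖x‖ + b) := by rw [hC]; field_simp; ring
  have hLT0 : 0 ≤ L * T := mul_nonneg hL hT
  have hC0 : 0 ≤ C := by positivity
  have hxC : ‖x‖ ≤ C := by nlinarith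
  suffices H : ∀ t ∈ Icc 0 T, ‖(picard f u)^[l] (fun _ => x) t‖ ≤ C from H T ⟨hT, le_rfl⟩
  induction l with
  | zero => intro t _; simpa using hxC
  | succ l ih =>
    intro t ht
    rw [Function.iterate_succ_apply']
    simp only [picard, picard_iterate_zero]
    have h2 := norm_integral_le_mul (h := fun τ => f ((picard f u)^[l] (fun _ => x) τ) (u τ))
      (b := L * C + L * b) (by positivity) ht fun s hs => by
        refine (hfGrowth _ _ (huU s hs)).trans ?_
        have := ih s hs
        have := hub s hs
        gcongr
    refine (norm_add_le _ _).trans ?_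
    nlinarith

/-- The distance of the iterates from the exact solution `ξ` contracts by `L T` at each iteration,
except for the mismatch of initial values. The latter is absorbed by the fixed point `C = L T C + ‖x
- ξ 0‖`, and `D` bounds the error of the constant initial guess. -/
theorem norm_stepApprox_sub_le (hL : 0 ≤ L)
    (hf : ContinuousOn (fun z : Vec n × Vec m => f z.1 z.2) (univ ×ˢ U))
    (hfLip : ∀ x y : Vec n, ∀ u ∈ U, ‖f x u - f y u‖ ≤ L * ‖x - y‖)
    {T : ℝ} (hT : 0 ≤ T) (hLT : L * T < 1) {u : ℝ → Vec m} (hu : ContinuousOn u (Icc 0 T))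
    (huU : ∀ t ∈ Icc 0 T, u t ∈ U) {ξ : ℝ → Vec n} (hξ : ContinuousOn ξ (Icc 0 T))
    (hξe : ∀ t ∈ Icc 0 T, ξ t = ξ 0 + ∫ τ in (0 : ℝ)..t, f (ξ τ) (u τ))
    {D : ℝ} (hD : ∀ t ∈ Icc 0 T, ‖ξ 0 - ξ t‖ ≤ D) (x : Vec n) (l : ℕ) :
    ‖stepApprox f T l u x - ξ T‖ ≤ (1 - L * T)⁻¹ * ‖x - ξ 0‖ + (L * T) ^ l * D := by
  set C := (1 - L * T)⁻¹ * ‖x - ξ 0‖ with hC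
  have h1 : 0 < 1 - L * T := by linarith
  have hCe : C = L * T * C + ‖x - ξ 0‖ := by rw [hC]; field_simp; ring
  have hLT0 : 0 ≤ L * T := mul_nonneg hL hT
  have hC0 : 0 ≤ C := by positivity
  have hD0 : 0 ≤ D := (norm_nonneg _).trans (hD 0 ⟨le_rfl, hT⟩)
  have hxC : ‖x - ξ 0‖ ≤ C := by nlinarith
  suffices H : ∀ t ∈ Icc 0 T, ‖(picard f u)^[l] (fun _ => x) t - ξ t‖ ≤ C + (L * T) ^ l * D from
    H T ⟨hT, le_rfl⟩
  induction l with
  | zero =>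
    intro t ht
    have := norm_sub_le_norm_sub_add_norm_sub x (ξ 0) (ξ t)
    have := hD t ht
    simp only [Function.iterate_zero, id_eq, pow_zero, one_mul]
    linarith
  | succ l ih =>
    intro t ht
    rw [Function.iterate_succ_apply', hξe t ht]
    simp only [picard, picard_iterate_zero]
    have hX := continuousOn_picard_iterate hf hT hu huU x l
    have h0 : (0 : ℝ) ∈ Icc 0 T := ⟨le_rfl, hT⟩
    rw [add_sub_add_comm, ← intervalIntegral.integral_sub
      (intervalIntegrable_of_continuousOn_Icc (continuousOn_rhs hf hX hu huU) h0 ht)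
      (intervalIntegrable_of_continuousOn_Icc (continuousOn_rhs hf hξ hu huU) h0 ht)]
    have h2 := norm_integral_le_mul
      (h := fun τ => f ((picard f u)^[l] (fun _ => x) τ) (u τ) - f (ξ τ) (u τ))
      (b := L * (C + (L * T) ^ l * D)) (by positivity) ht fun s hs => by
        refine (hfLip _ _ _ (huU s hs)).trans ?_
        exact mul_le_mul_of_nonneg_left (ih s hs) hL
    refine (norm_add_le _ _).trans ?_
    rw [pow_succ]
    nlinarith

/-- Adding `b` to both sides turns the affine recursion over the steps into a homogeneous one, which
iterates to a power. -/
theorem norm_composeApprox_le (hL : 0 ≤ L)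
    (hfGrowth : ∀ x : Vec n, ∀ u ∈ U, ‖f x u‖ ≤ L * ‖x‖ + L * ‖u‖)
    {T : ℝ} (hT : 0 ≤ T) (hLT : L * T < 1) {u : ℝ → Vec m} {b : ℝ} (hb : 0 ≤ b)
    (huU : ∀ t, u t ∈ U) (hub : ∀ t, ‖u t‖ ≤ b) (x : Vec n) (l i : ℕ) :
    ‖composeApprox f T l u x i‖ + b ≤ ((1 - L * T)⁻¹ + 1) ^ i * (‖x‖ + b) := by
  induction i with
  | zero => simp [composeApprox]
  | succ i ih =>
    have h1 : 0 < 1 - L * T := by linarith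
    have hC : 0 ≤ (1 - L * T)⁻¹ := by positivity
    have h2 := norm_stepApprox_le hL hfGrowth hT hLT hb (u := fun s => u (s + i * T))
      (fun t _ => huU _) (fun t _ => hub _) (composeApprox f T l u x i) l
    rw [composeApprox, pow_succ', mul_assoc]
    have h3 := mul_le_mul_of_nonneg_left ih (by positivity : 0 ≤ (1 - L * T)⁻¹ + 1)
    have := norm_nonneg (composeApprox f T l u x i)
    linarith

/-- With `ρ = (L T)^l * (2 B)`, the errors satisfy `e_{i+1} ≤ c e_i + ρ`, where `c = (1 - L T)⁻¹ ≥
1`. Adding `ρ` gives the homogeneous recursion `e_{i+1} + ρ ≤ (c + 1) (e_i + ρ)`. -/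
theorem norm_composeApprox_sub_le (hL : 0 ≤ L)
    (hf : ContinuousOn (fun z : Vec n × Vec m => f z.1 z.2) (univ ×ˢ U))
    (hfLip : ∀ x y : Vec n, ∀ u ∈ U, ‖f x u - f y u‖ ≤ L * ‖x - y‖)
    {T r : ℝ} (hT : 0 ≤ T) (hLT : L * T < 1) {q : ℕ} (hr : q * T = r)
    {u : ℝ → Vec m} (hu : ContinuousOn u (Icc 0 r))
    (huU : ∀ t, u t ∈ U) {ξ : ℝ → Vec n} (hξ : ContinuousOn ξ (Icc 0 r))
    (hξe : ∀ t ∈ Icc 0 r, ξ t = ξ 0 + ∫ τ in (0 : ℝ)..t, f (ξ τ) (u τ))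
    {B : ℝ} (hB : ∀ t ∈ Icc 0 r, ‖ξ t‖ ≤ B) (l i : ℕ) (hi : i ≤ q) :
    ‖composeApprox f T l u (ξ 0) i - ξ (i * T)‖ + (L * T) ^ l * (2 * B) ≤
      ((1 - L * T)⁻¹ + 1) ^ i * ((L * T) ^ l * (2 * B)) := by
  have hr0 : 0 ≤ r := by rw [← hr]; positivity
  induction i with
  | zero => simp [composeApprox]
  | succ i ih =>
    have ih := ih (by omega)
    have h1 : 0 < 1 - L * T := by linarith
    have hLT0 : 0 ≤ L * T := mul_nonneg hL hT
    have hC : 1 ≤ (1 - L * T)⁻¹ := (one_le_inv₀ h1).2 (by linarith)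
    have hiq : (i + 1 : ℝ) * T ≤ r := by
      rw [← hr]
      exact mul_le_mul_of_nonneg_right (by exact_mod_cast hi) hT
    have hi0 : 0 ≤ (i : ℝ) * T := by positivity
    have hsub : ∀ s ∈ Icc 0 T, s + i * T ∈ Icc 0 r := by
      intro s hs
      exact ⟨by linarith [hs.1], by linarith [hs.2]⟩
    have hmap : ContinuousOn (fun s : ℝ => s + i * T) (Icc 0 T) := by fun_prop
    have hrhs := continuousOn_rhs hf hξ hu fun t _ => huU t
    have hii : (i : ℝ) * T ∈ Icc 0 r := ⟨hi0, by linarith⟩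
    have h2 := norm_stepApprox_sub_le hL hf hfLip hT hLT (u := fun s => u (s + i * T))
      (ξ := fun s => ξ (s + i * T)) (hu.comp hmap hsub) (fun t _ => huU _) (hξ.comp hmap hsub)
      (by
        intro t ht
        simp only [zero_add]
        rw [intervalIntegral.integral_comp_add_right (fun s => f (ξ s) (u s)) ((i : ℝ) * T),
          hξe _ (hsub t ht), hξe _ hii, zero_add, add_assoc,
          intervalIntegral.integral_add_adjacent_intervals
            (intervalIntegrable_of_continuousOn_Icc hrhs ⟨le_rfl, hr0⟩ hii)
            (intervalIntegrable_of_continuousOn_Icc hrhs hii (hsub t ht))])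
      (D := 2 * B) (by
        intro t ht
        refine (norm_sub_le _ _).trans ?_
        have := hB _ (hsub t ht)
        have := hB _ hii
        simp only [zero_add]
        linarith)
      (composeApprox f T l u (ξ 0) i) l
    simp only [zero_add] at h2
    rw [composeApprox, pow_succ', mul_assoc]
    have h3 := mul_le_mul_of_nonneg_left ih (by positivity : 0 ≤ (1 - L * T)⁻¹ + 1)
    have h4 := norm_nonneg (composeApprox f T l u (ξ 0) i - ξ (i * T))
    have h5 : 0 ≤ (L * T) ^ l * (2 * B) := by
      have := (norm_nonneg _).trans (hB 0 ⟨le_rfl, hr0⟩)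
      positivity
    have h6 : ((i + 1 : ℕ) : ℝ) * T = T + i * T := by push_cast; ring
    rw [h6]
    nlinarith

theorem norm_flowApprox_le (hL : 0 ≤ L) {r : ℝ} (hr : 0 ≤ r) {q : ℕ} (hq : 0 < q)
    (hLrq : L * r < q)
    (hfGrowth : ∀ x : Vec n, ∀ u ∈ U, ‖f x u‖ ≤ L * ‖x‖ + L * ‖u‖) :
    ∃ C : ℝ, 0 ≤ C ∧ ∀ (l : ℕ) (u : ℝ → Vec m) (x : Vec n) (b : ℝ), 0 ≤ b → (∀ t, u t ∈ U) →
      (∀ t, ‖u t‖ ≤ b) → ‖flowApprox f r l q u x‖ ≤ C * (‖x‖ + b) := by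
  have hq' : (0 : ℝ) < q := by exact_mod_cast hq
  have hLT : L * (r / q) < 1 := by rw [← mul_div_assoc, div_lt_one hq']; exact hLrq
  have h1 : 0 < 1 - L * (r / q) := by linarith
  refine ⟨((1 - L * (r / q))⁻¹ + 1) ^ q, by positivity, fun l u x b hb huU hub => ?_⟩
  have := norm_composeApprox_le hL hfGrowth (by positivity) hLT hb huU hub x l q
  unfold flowApprox
  linarith

theorem norm_flowApprox_sub_le (hL : 0 ≤ L) {r : ℝ} (hr : 0 ≤ r) {q : ℕ} (hq : 0 < q)
    (hLrq : L * r < q)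
    (hf : ContinuousOn (fun z : Vec n × Vec m => f z.1 z.2) (univ ×ˢ U))
    (hfLip : ∀ x y : Vec n, ∀ u ∈ U, ‖f x u - f y u‖ ≤ L * ‖x - y‖) :
    ∃ ε : ℕ → ℝ, Tendsto ε atTop (𝓝 0) ∧ (∀ l, 0 ≤ ε l) ∧
      ∀ (l : ℕ) (u : ℝ → Vec m) (ξ : ℝ → Vec n) (B : ℝ), ContinuousOn u (Icc 0 r) →
        (∀ t, u t ∈ U) → ContinuousOn ξ (Icc 0 r) →
        (∀ t ∈ Icc 0 r, ξ t = ξ 0 + ∫ τ in (0 : ℝ)..t, f (ξ τ) (u τ)) →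
        (∀ t ∈ Icc 0 r, ‖ξ t‖ ≤ B) → ‖flowApprox f r l q u (ξ 0) - ξ r‖ ≤ ε l * B := by
  have hq' : (0 : ℝ) < q := by exact_mod_cast hq
  have hLT : L * (r / q) < 1 := by rw [← mul_div_assoc, div_lt_one hq']; exact hLrq
  have hLT0 : 0 ≤ L * (r / q) := by positivity
  have h1 : 0 < 1 - L * (r / q) := by linarith
  refine ⟨fun l => ((1 - L * (r / q))⁻¹ + 1) ^ q * 2 * (L * (r / q)) ^ l, ?_, fun l => by
    positivity, fun l u ξ B hu huU hξ hξe hB => ?_⟩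
  · simpa using (tendsto_pow_atTop_nhds_zero_of_lt_one hLT0 hLT).const_mul
      (((1 - L * (r / q))⁻¹ + 1) ^ q * 2)
  · have hqr : (q : ℝ) * (r / q) = r := by field_simp
    have := norm_composeApprox_sub_le hL hf hfLip (by positivity) hLT hqr hu huU hξ hξe hB
      l q le_rfl
    rw [hqr] at this
    have hB0 : 0 ≤ B := (norm_nonneg _).trans (hB 0 ⟨le_rfl, hr⟩)
    have : 0 ≤ (L * (r / q)) ^ l * (2 * B) := by positivity
    unfold flowApprox
    linarith

end Picard

theorem exists_norm_le_Icc {E : Type*} [NormedAddCommGroup E] {y : ℝ → E} {a b : ℝ}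
    (hy : ContinuousOn y (Icc a b)) :
    ∃ B : ℝ, 0 ≤ B ∧ ∀ s ∈ Icc a b, ‖y s‖ ≤ B := by
  obtain ⟨B, hB⟩ := isCompact_Icc.exists_bound_of_continuousOn hy
  exact ⟨max B 0, le_max_right _ _, fun s hs => (hB s hs).trans (le_max_left _ _)⟩

/-! ### Causal functional differential equations: uniqueness and global existence -/

section Volterra

variable {E : Type*} [NormedAddCommGroup E]

/-- `Φ` is a causal right-hand side, of linear growth and Lipschitz on bounded sets, so that
`y'(t) = Φ y t` is a functional differential equation which can be solved forward in time. -/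
structure IsVolterra (Φ : (ℝ → E) → ℝ → E) : Prop where
  continuousOn : ∀ y, Continuous y → ContinuousOn (Φ y) (Ici 0)
  growth : ∃ G c : ℝ, 0 ≤ G ∧ 0 ≤ c ∧ ∀ y t b, 0 ≤ t → ContinuousOn y (Icc 0 t) →
    (∀ s ∈ Icc 0 t, ‖y s‖ ≤ b) → ‖Φ y t‖ ≤ G * (c + b)
  lipschitz : ∀ B : ℝ, ∃ K : ℝ, 0 ≤ K ∧ ∀ y z t b, 0 ≤ t → ContinuousOn y (Icc 0 t) →
    ContinuousOn z (Icc 0 t) → (∀ s ∈ Icc 0 t, ‖y s‖ ≤ B) → (∀ s ∈ Icc 0 t, ‖z s‖ ≤ B) →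
    (∀ s ∈ Icc 0 t, ‖y s - z s‖ ≤ b) → ‖Φ y t - Φ z t‖ ≤ K * b

variable {Φ : (ℝ → E) → ℝ → E}

/-- Causality is the Lipschitz bound with `b = 0`. -/
theorem IsVolterra.congr (hΦ : IsVolterra Φ) {y z : ℝ → E} {t : ℝ} (ht : 0 ≤ t)
    (hy : ContinuousOn y (Icc 0 t)) (h : EqOn y z (Icc 0 t)) : Φ y t = Φ z t := by
  obtain ⟨B, -, hB⟩ := exists_norm_le_Icc hy
  obtain ⟨K, -, hK⟩ := hΦ.lipschitz B
  have := hK y z t 0 ht hy (hy.congr h.symm) hB (fun s hs => h hs ▸ hB s hs)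
    (fun s hs => by simp [h hs])
  rw [mul_zero] at this
  exact sub_eq_zero.1 (norm_le_zero_iff.1 this)

variable [NormedSpace ℝ E]

/-- Let `Δ` be the maximum of `exp (-lam t) ‖y t - z t‖`, attained at `τ`. Integrating the Lipschitz
estimate up to `τ` gives `Δ ≤ (K / lam) Δ`, and `K / lam < 1` forces `Δ = 0`. -/
theorem IsVolterra.unique (hΦ : IsVolterra Φ) {y z : ℝ → E} {a : ℝ}
    (hy : ∀ t ∈ Ico 0 a, HasDerivWithinAt y (Φ y t) (Ico 0 a) t)
    (hz : ∀ t ∈ Ico 0 a, HasDerivWithinAt z (Φ z t) (Ico 0 a) t) (h0 : y 0 = z 0) :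
    EqOn y z (Ico 0 a) := by
  intro T hT
  have hsub : Icc 0 T ⊆ Ico 0 a := fun s hs => ⟨hs.1, hs.2.trans_lt hT.2⟩
  have hyc : ContinuousOn y (Icc 0 T) := fun t ht => ((hy t (hsub ht)).continuousWithinAt).mono hsub
  have hzc : ContinuousOn z (Icc 0 T) := fun t ht => ((hz t (hsub ht)).continuousWithinAt).mono hsub
  obtain ⟨B₁, -, hB₁⟩ := exists_norm_le_Icc hyc
  obtain ⟨B₂, -, hB₂⟩ := exists_norm_le_Icc hzc
  obtain ⟨K, hK0, hK⟩ := hΦ.lipschitz (max B₁ B₂)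
  set lam := 2 * K + 1 with hlam
  obtain ⟨τ, hτ, hmax⟩ := (isCompact_Icc (a := (0 : ℝ)) (b := T)).exists_isMaxOn
    ⟨0, le_rfl, hT.1⟩ (f := fun t => Real.exp (-lam * t) * ‖y t - z t‖)
    ((Continuous.continuousOn (by fun_prop)).mul (hyc.sub hzc).norm)
  set Δ := Real.exp (-lam * τ) * ‖y τ - z τ‖ with hΔ
  have hΔ0 : 0 ≤ Δ := by positivity
  have hbd : ∀ s ∈ Icc 0 T, ‖y s - z s‖ ≤ Δ * Real.exp (lam * s) := by
    intro s hs
    have h1 : Real.exp (-lam * s) * ‖y s - z s‖ ≤ Δ := hmax hs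
    have h2 : Real.exp (lam * s) * Real.exp (-lam * s) = 1 := by
      rw [← Real.exp_add]; simp
    have := mul_le_mul_of_nonneg_left h1 (Real.exp_pos (lam * s)).le
    rw [← mul_assoc, h2, one_mul] at this
    linarith
  have hlam0 : 0 < lam := by positivity
  have hder : ∀ x ∈ Ico (0 : ℝ) T, ∀ w : ℝ → E,
      (∀ t ∈ Ico 0 a, HasDerivWithinAt w (Φ w t) (Ico 0 a) t) →
      HasDerivWithinAt w (Φ w x) (Ici x) x := by
    intro x hx w hw
    refine (hw x ⟨hx.1, hx.2.trans hT.2⟩).mono_of_mem_nhdsWithin ?_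
    exact mem_of_superset (Ico_mem_nhdsGE (hx.2.trans hT.2))
      fun s hs => ⟨hx.1.trans hs.1, hs.2⟩
  have key := image_norm_le_of_norm_deriv_right_le_deriv_boundary
    (f := fun t => y t - z t) (f' := fun t => Φ y t - Φ z t) (a := 0) (b := T)
    (B := fun t => Δ * K / lam * Real.exp (lam * t))
    (B' := fun t => Δ * K * Real.exp (lam * t)) (hyc.sub hzc)
    (fun x hx => (hder x hx y hy).sub (hder x hx z hz))
    (by rw [h0, sub_self, norm_zero]; positivity)
    (fun x => by
      have := (((hasDerivAt_id x).const_mul lam).exp).const_mul (Δ * K / lam)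
      refine this.congr_deriv ?_
      simp only [id, mul_one]
      field_simp)
    (fun x hx => by
      have hsub' : Icc 0 x ⊆ Icc 0 T := Icc_subset_Icc_right hx.2.le
      have := hK y z x (Δ * Real.exp (lam * x)) hx.1 (hyc.mono hsub') (hzc.mono hsub')
        (fun s hs => (hB₁ s (hsub' hs)).trans (le_max_left _ _))
        (fun s hs => (hB₂ s (hsub' hs)).trans (le_max_right _ _))
        (fun s hs => (hbd s (hsub' hs)).trans (by
          have := hs.2
          gcongr))
      linarith)
    hτ
  have h1 : ‖y τ - z τ‖ = Δ * Real.exp (lam * τ) := by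
    rw [hΔ, mul_right_comm, ← Real.exp_add]; simp
  have h2 : Δ ≤ Δ * K / lam := by
    simp only [h1] at key
    exact le_of_mul_le_mul_right key (Real.exp_pos _)
  have h3 : Δ = 0 := by
    rw [le_div_iff₀ hlam0] at h2
    nlinarith
  have h4 := hbd T ⟨hT.1, le_rfl⟩
  rw [h3, zero_mul] at h4
  exact sub_eq_zero.1 (norm_le_zero_iff.1 h4)

theorem norm_integral_le_exp {h : ℝ → E} {t c lam : ℝ} (hlam : 0 < lam) (hc : 0 ≤ c)
    (ht : 0 ≤ t) (hh : ∀ s ∈ Icc 0 t, ‖h s‖ ≤ c * Real.exp (lam * s)) :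
    ‖∫ s in (0 : ℝ)..t, h s‖ ≤ c / lam * Real.exp (lam * t) := by
  have h1 : ‖∫ s in (0 : ℝ)..t, h s‖ ≤ ∫ s in (0 : ℝ)..t, c * Real.exp (lam * s) := by
    refine intervalIntegral.norm_integral_le_of_norm_le ht (ae_of_all _ fun s hs => ?_)
      (Continuous.intervalIntegrable (by fun_prop) _ _)
    exact hh s ⟨hs.1.le, hs.2⟩
  have h2 : ∫ s in (0 : ℝ)..t, c * Real.exp (lam * s) =
      c / lam * Real.exp (lam * t) - c / lam * Real.exp (lam * 0) := by
    refine intervalIntegral.integral_eq_sub_of_hasDerivAt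
      (f := fun s => c / lam * Real.exp (lam * s)) (fun s _ => ?_)
      (Continuous.intervalIntegrable (by fun_prop) _ _)
    have := (((hasDerivAt_id s).const_mul lam).exp).const_mul (c / lam)
    refine this.congr_deriv ?_
    simp only [id, mul_one]
    field_simp
  have : 0 ≤ c / lam * Real.exp (lam * 0) := by positivity
  linarith

variable [CompleteSpace E]

/-- The interval length is arbitrary. The unknown is `h t = exp (-lam t) • y t`, so that the sup
norm of `h` is an exponentially weighted norm of `y`. As the right-hand side is Lipschitz only on
bounded sets, the contraction takes place on a set `W` encoding the a priori bound `‖y t‖ ≤ C₀ exp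
(lam₀ t)`. -/
theorem IsVolterra.exists_local (hΦ : IsVolterra Φ) (y₀ : E) {T : ℝ} (hT : 0 ≤ T) :
    ∃ y : ℝ → E, Continuous y ∧ y 0 = y₀ ∧
      ∀ t ∈ Icc 0 T, HasDerivWithinAt y (Φ y t) (Icc 0 T) t := by
  obtain ⟨G, c, hG, hc, hgrowth⟩ := hΦ.growth
  -- These make `W` invariant: `‖y₀‖ ≤ C₀ / 2`, and the integral contributes at most `2 G C₀ / lam₀
  -- ≤ C₀ / 2` times `exp (lam₀ t)`.
  set lam₀ := 4 * G + 1 with hlam₀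
  set C₀ := 2 * ‖y₀‖ + c with hC₀
  have hlam₀0 : 0 < lam₀ := by positivity
  have hC₀0 : 0 ≤ C₀ := by positivity
  obtain ⟨K, hK, hlip⟩ := hΦ.lipschitz (C₀ * Real.exp (lam₀ * T))
  -- `K` is the Lipschitz constant on the range allowed by `W`; this weight makes `K / lam ≤ 1 / 2`.
  set lam := 2 * K + 1 with hlam
  have hlam0 : 0 < lam := by positivity
  let ext : C(Icc 0 T, E) → ℝ → E := fun h s => Real.exp (lam * s) • IccExtend hT h s
  have ext_cont : ∀ h, Continuous (ext h) := fun h =>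
    (by fun_prop : Continuous fun s : ℝ => Real.exp (lam * s)).smul h.continuous.Icc_extend'
  have ext_apply : ∀ h, ∀ s (hs : s ∈ Icc 0 T), ext h s = Real.exp (lam * s) • h ⟨s, hs⟩ :=
    fun h s hs => by simp only [ext, IccExtend_of_mem hT h hs]
  -- Freezing the argument at `0` for negative times makes the integrand continuous on the whole
  -- line, so its primitive is differentiable everywhere.
  let Ψ : C(Icc 0 T, E) → ℝ → E := fun h s => Φ (ext h) (max s 0)
  have Ψ_cont : ∀ h, Continuous (Ψ h) := fun h =>
    (hΦ.continuousOn _ (ext_cont h)).comp_continuous (by fun_prop) fun s => mem_Ici.2 (le_max_right _ _)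
  have Ψ_apply : ∀ h, ∀ s, 0 ≤ s → Ψ h s = Φ (ext h) s := fun h s hs => by
    simp only [Ψ, max_eq_left hs]
  have prim_deriv : ∀ h t, HasDerivAt (fun t => y₀ + ∫ s in (0 : ℝ)..t, Ψ h s) (Ψ h t) t :=
    fun h t => ((Ψ_cont h).integral_hasStrictDerivAt 0 t).hasDerivAt.const_add y₀
  have prim_cont : ∀ h, Continuous (fun t => y₀ + ∫ s in (0 : ℝ)..t, Ψ h s) := fun h =>
    continuous_iff_continuousAt.2 fun t => (prim_deriv h t).continuousAt
  let S : C(Icc 0 T, E) → C(Icc 0 T, E) := fun h =>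
    ⟨fun t => Real.exp (-lam * t) • (y₀ + ∫ s in (0 : ℝ)..t, Ψ h s),
      (by fun_prop : Continuous fun t : Icc 0 T => Real.exp (-lam * t)).smul
        ((prim_cont h).comp continuous_subtype_val)⟩
  let W : Set C(Icc 0 T, E) :=
    {h | ∀ t : Icc 0 T, ‖h t‖ ≤ C₀ * Real.exp ((lam₀ - lam) * t)}
  have hWclosed : IsClosed W := by
    simp only [W, ofPred_forall]
    exact isClosed_iInter fun t => isClosed_le (by fun_prop) continuous_const
  have hWext : ∀ h ∈ W, ∀ s ∈ Icc 0 T, ‖ext h s‖ ≤ C₀ * Real.exp (lam₀ * s) := by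
    intro h hh s hs
    rw [ext_apply h s hs, norm_smul, Real.norm_eq_abs, Real.abs_exp]
    have h1 := mul_le_mul_of_nonneg_left (hh ⟨s, hs⟩) (Real.exp_pos (lam * s)).le
    refine h1.trans (le_of_eq ?_)
    rw [mul_left_comm, ← Real.exp_add]
    congr 2
    simp only
    ring
  have hexp : ∀ t : ℝ, ∀ a C : ℝ, ∀ v : E, ‖v‖ ≤ C * Real.exp (a * t) →
      ‖Real.exp (-lam * t) • v‖ ≤ C * Real.exp ((a - lam) * t) := by
    intro t a C v hv
    rw [norm_smul, Real.norm_eq_abs, Real.abs_exp]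
    refine (mul_le_mul_of_nonneg_left hv (Real.exp_pos _).le).trans (le_of_eq ?_)
    rw [mul_left_comm, ← Real.exp_add]
    congr 2
    ring
  have hmaps : MapsTo S W W := by
    intro h hh t
    refine hexp t lam₀ C₀ _ ?_
    have h1 : ‖∫ s in (0 : ℝ)..t, Ψ h s‖ ≤ 2 * G * C₀ / lam₀ * Real.exp (lam₀ * t) := by
      refine norm_integral_le_exp hlam₀0 (by positivity) t.2.1 fun s hs => ?_
      rw [Ψ_apply h s hs.1]
      have hsT : s ≤ T := hs.2.trans t.2.2
      refine (hgrowth _ s (C₀ * Real.exp (lam₀ * s)) hs.1 (ext_cont h).continuousOn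
        fun s' hs' => (hWext h hh s' ⟨hs'.1, hs'.2.trans hsT⟩).trans ?_).trans ?_
      · have := hs'.2
        gcongr
      · have h2 : 1 ≤ Real.exp (lam₀ * s) := Real.one_le_exp (mul_nonneg hlam₀0.le hs.1)
        have h3 : c ≤ C₀ * Real.exp (lam₀ * s) := by
          have : c ≤ C₀ := by rw [hC₀]; linarith [norm_nonneg y₀]
          nlinarith
        have := mul_le_mul_of_nonneg_left h3 hG
        linarith
    have h2 : 2 * G * C₀ / lam₀ ≤ C₀ / 2 := by
      rw [div_le_div_iff₀ hlam₀0 two_pos, hlam₀]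
      nlinarith
    have h3 : 1 ≤ Real.exp (lam₀ * t) := Real.one_le_exp (mul_nonneg hlam₀0.le t.2.1)
    have h4 : ‖y₀‖ ≤ C₀ / 2 := by rw [hC₀]; linarith
    have h5 : C₀ / 2 ≤ C₀ / 2 * Real.exp (lam₀ * t) := le_mul_of_one_le_right (by positivity) h3
    have h6 := mul_le_mul_of_nonneg_right h2 (Real.exp_pos (lam₀ * t)).le
    refine (norm_add_le _ _).trans ?_
    linarith
  have hcontr : ∀ h ∈ W, ∀ h' ∈ W, dist (S h) (S h') ≤ (1 / 2 : ℝ) * dist h h' := by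
    intro h hh h' hh'
    refine (ContinuousMap.dist_le (by positivity)).2 fun t => ?_
    have h1 : ‖∫ s in (0 : ℝ)..t, (Ψ h s - Ψ h' s)‖ ≤
        K * dist h h' / lam * Real.exp (lam * t) := by
      refine norm_integral_le_exp hlam0 (by positivity) t.2.1 fun s hs => ?_
      rw [Ψ_apply h s hs.1, Ψ_apply h' s hs.1, mul_assoc]
      have hsT : s ≤ T := hs.2.trans t.2.2
      have hb : ∀ k ∈ W, ∀ s' ∈ Icc 0 s, ‖ext k s'‖ ≤ C₀ * Real.exp (lam₀ * T) := by
        intro k hk s' hs'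
        refine (hWext k hk s' ⟨hs'.1, hs'.2.trans hsT⟩).trans ?_
        have := hs'.2.trans hsT
        gcongr
      refine hlip _ _ s _ hs.1 (ext_cont h).continuousOn (ext_cont h').continuousOn
        (hb h hh) (hb h' hh') fun s' hs' => ?_
      have hs'T : s' ∈ Icc 0 T := ⟨hs'.1, hs'.2.trans hsT⟩
      rw [ext_apply h s' hs'T, ext_apply h' s' hs'T, ← smul_sub, norm_smul, Real.norm_eq_abs,
        Real.abs_exp, mul_comm, ← dist_eq_norm]
      have := hs'.2
      have := ContinuousMap.dist_apply_le_dist (f := h) (g := h') ⟨s', hs'T⟩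
      gcongr
    have h2 : K * dist h h' / lam ≤ 1 / 2 * dist h h' := by
      rw [div_le_iff₀ hlam0, hlam]
      have := dist_nonneg (x := h) (y := h')
      nlinarith
    have h3 := hexp t lam _ _ h1
    rw [sub_self, zero_mul, Real.exp_zero, mul_one] at h3
    rw [dist_eq_norm]
    have h4 : S h t - S h' t = Real.exp (-lam * t) • ∫ s in (0 : ℝ)..t, (Ψ h s - Ψ h' s) := by
      rw [intervalIntegral.integral_sub ((Ψ_cont h).intervalIntegrable _ _)
        ((Ψ_cont h').intervalIntegrable _ _)]
      simp only [S, ContinuousMap.coe_mk, ← smul_sub, add_sub_add_left_eq_sub]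
    rw [h4]
    exact h3.trans h2
  have hC : ContractingWith (1 / 2) (hmaps.restrict S W W) := by
    refine ⟨by norm_num, LipschitzWith.of_dist_le_mul fun h h' => ?_⟩
    have := hcontr h h.2 h' h'.2
    simpa [Subtype.dist_eq] using this
  obtain ⟨h, -, hfix, -⟩ := hC.exists_fixedPoint' hWclosed.isComplete hmaps (x := 0)
    (fun t => by simp only [ContinuousMap.zero_apply, norm_zero]; positivity) (edist_ne_top _ _)
  have hsol : ∀ t ∈ Icc 0 T, ext h t = y₀ + ∫ s in (0 : ℝ)..t, Ψ h s := by
    intro t ht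
    have h1 : h ⟨t, ht⟩ = Real.exp (-lam * t) • (y₀ + ∫ s in (0 : ℝ)..t, Ψ h s) :=
      (congrArg (fun k : C(Icc 0 T, E) => k ⟨t, ht⟩) hfix).symm
    rw [ext_apply h t ht, h1, smul_smul, ← Real.exp_add]
    simp
  refine ⟨ext h, ext_cont h, ?_, fun t ht => ?_⟩
  · rw [hsol 0 ⟨le_rfl, hT⟩]; simp
  · rw [← Ψ_apply h t ht.1]
    exact (prim_deriv h t).hasDerivWithinAt.congr hsol (hsol t ht)

theorem IsVolterra.exists_global (hΦ : IsVolterra Φ) (y₀ : E) :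
    ∃ y : ℝ → E, y 0 = y₀ ∧ ∀ t, 0 ≤ t → HasDerivWithinAt y (Φ y t) (Ici 0) t := by
  choose Y hYc hY0 hYd using fun N : ℕ => hΦ.exists_local y₀ (T := N + 1) (by positivity)
  have hYd' : ∀ N : ℕ, ∀ a : ℝ, a ≤ N + 1 →
      ∀ t ∈ Ico 0 a, HasDerivWithinAt (Y N) (Φ (Y N) t) (Ico 0 a) t := fun N a ha t ht =>
    (hYd N t ⟨ht.1, ht.2.le.trans ha⟩).mono fun s hs => ⟨hs.1, hs.2.le.trans ha⟩
  have hcons : ∀ M N : ℕ, M ≤ N → EqOn (Y M) (Y N) (Ico 0 (M + 1)) := fun M N h =>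
    hΦ.unique (hYd' M _ le_rfl) (hYd' N _ (by gcongr)) (by rw [hY0, hY0])
  -- `Y N` solves up to `N + 1`, so `t` lies strictly before the end of the interval of `Y ⌊t⌋₊`. By
  -- uniqueness the choice of piece does not matter.
  let y : ℝ → E := fun t => Y ⌊t⌋₊ t
  have hy : ∀ M : ℕ, EqOn y (Y M) (Ico 0 (M + 1)) := fun M t ht =>
    hcons _ _ (Nat.lt_succ_iff.1 ((Nat.floor_lt ht.1).2 (by exact_mod_cast ht.2)))
      ⟨ht.1, Nat.lt_floor_add_one t⟩
  refine ⟨y, (hy 0 ⟨le_rfl, by norm_num⟩).trans (hY0 0), fun t ht => ?_⟩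
  set M := ⌊t⌋₊
  have htM : t < M + 1 := Nat.lt_floor_add_one t
  have hEq : EqOn (Y M) y (Icc 0 t) := fun s hs => (hy M ⟨hs.1, hs.2.trans_lt htM⟩).symm
  rw [← hΦ.congr ht (hYc M).continuousOn hEq]
  have h1 : HasDerivWithinAt y (Φ (Y M) t) (Ico 0 (M + 1)) t :=
    (hYd' M _ le_rfl t ⟨ht, htM⟩).congr (hy M) (hy M ⟨ht, htM⟩)
  refine h1.mono_of_mem_nhdsWithin ?_
  rw [← Ici_inter_Iio]
  exact inter_mem_nhdsWithin _ (Iio_mem_nhds htM)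

end Volterra

/-! ### Histories and their continuity in time -/

section History

variable {m : ℕ} {r : ℝ} {u u' : ℝ → Vec m} {t : ℝ}

theorem add_mem_Icc_of_hist (t : ℝ) (θ : Icc (-r) (0 : ℝ)) : t + θ ∈ Icc (t - r) t :=
  ⟨by linarith [θ.2.1], by linarith [θ.2.2]⟩

theorem history_congr (h : EqOn u u' (Icc (t - r) t)) : history r u t = history r u' t := by
  have : (fun θ : Icc (-r) (0 : ℝ) => u (t + θ)) = fun θ : Icc (-r) (0 : ℝ) => u' (t + θ) :=
    funext fun θ => h (add_mem_Icc_of_hist t θ)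
  unfold history
  by_cases hc : Continuous fun θ : Icc (-r) (0 : ℝ) => u (t + θ)
  · rw [dif_pos hc, dif_pos (this ▸ hc)]
    ext1 θ
    exact congrFun this θ
  · rw [dif_neg hc, dif_neg (this ▸ hc)]

theorem norm_history_le {b : ℝ} (hb : 0 ≤ b) (hu : ContinuousOn u (Icc (t - r) t))
    (h : ∀ s ∈ Icc (t - r) t, ‖u s‖ ≤ b) : ‖history r u t‖ ≤ b :=
  (ContinuousMap.norm_le _ hb).2 fun θ => by
    rw [history_apply hu]; exact h _ (add_mem_Icc_of_hist t θ)

theorem norm_history_sub_le {b : ℝ} (hb : 0 ≤ b) (hu : ContinuousOn u (Icc (t - r) t))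
    (hu' : ContinuousOn u' (Icc (t - r) t)) (h : ∀ s ∈ Icc (t - r) t, ‖u s - u' s‖ ≤ b) :
    ‖history r u t - history r u' t‖ ≤ b :=
  (ContinuousMap.norm_le _ hb).2 fun θ => by
    rw [ContinuousMap.sub_apply, history_apply hu, history_apply hu']
    exact h _ (add_mem_Icc_of_hist t θ)

theorem continuous_history (hu : Continuous u) : Continuous (history r u) := by
  let F : C(ℝ, Hist r m) := ContinuousMap.curry
    ⟨fun z : ℝ × Icc (-r) (0 : ℝ) => u (z.1 + z.2), by fun_prop⟩
  have : history r u = F := by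
    ext1 t
    ext1 θ
    rw [history_apply hu.continuousOn]
    rfl
  rw [this]
  exact F.continuous

/-- Near `t`, the pairs of state and history form the image of a compact interval, hence a bounded
set with `U`-valued histories, on which `F` is Lipschitz. -/
theorem CompletelyLipschitz.continuous_comp {n : ℕ} {U : Set (Vec m)}
    {F : Vec n → Hist r m → Vec m} (hF : CompletelyLipschitz U r F) {x : ℝ → Vec n}
    (hx : Continuous x) (hu : Continuous u) (huU : ∀ t, u t ∈ U) :
    Continuous fun t => F (x t) (history r u t) := by
  have hh := continuous_history (r := r) hu
  refine continuous_iff_continuousAt.2 fun t => ?_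
  let S : Set (Vec n × Hist r m) := (fun s => (x s, history r u s)) '' Icc (t - 1) (t + 1)
  have hS : Bornology.IsBounded S := (isCompact_Icc.image (hx.prodMk hh)).isBounded
  have hSU : ∀ z ∈ S, ∀ θ, z.2 θ ∈ U := by
    rintro _ ⟨s, -, rfl⟩ θ
    have : history r u s θ = u (s + θ) := history_apply hu.continuousOn θ
    exact this ▸ huU _
  obtain ⟨C, -, hC⟩ := hF S hS hSU
  have hmem : ∀ s ∈ Icc (t - 1) (t + 1), (x s, history r u s) ∈ S := fun s hs => ⟨s, hs, rfl⟩
  have hlim : Tendsto (fun s => C * ‖x s - x t‖ + C * ‖history r u s - history r u t‖) (𝓝 t)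
      (𝓝 0) := by
    have h1 := tendsto_iff_norm_sub_tendsto_zero.1 (hx.tendsto t)
    have h2 := tendsto_iff_norm_sub_tendsto_zero.1 (hh.tendsto t)
    have h3 := (h1.const_mul C).add (h2.const_mul C)
    rwa [mul_zero, add_zero] at h3
  have hlim' : Tendsto (fun s => ‖F (x s) (history r u s) - F (x t) (history r u t)‖) (𝓝 t)
      (𝓝 0) := by
    refine squeeze_zero' (Eventually.of_forall fun _ => norm_nonneg _) ?_ hlim
    filter_upwards [Icc_mem_nhds (by linarith : t - 1 < t) (by linarith : t < t + 1)] with s hs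
    have hts : t ∈ Icc (t - 1) (t + 1) := ⟨by linarith, by linarith⟩
    have := hC (x s, history r u s) (hmem s hs) (x t, history r u t) (hmem t hts)
    exact this
  exact tendsto_iff_norm_sub_tendsto_zero.2 hlim'

end History

/-! ### Extension of the control by its initial history -/

section Glue

variable {m : ℕ} {r : ℝ}

/-- The function equal to `w` on `[0,∞)` and to `w₀` on `[-r,0]`, the latter shifted by a constant
in case that `w 0 ≠ w₀ 0`, so that it is continuous for every continuous `w`. -/
noncomputable def glue (hr : -r ≤ 0) (w₀ : Hist r m) (w : ℝ → Vec m) (s : ℝ) : Vec m :=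
  IccExtend hr w₀ s + (w (max s 0) - w₀ ⟨0, hr, le_rfl⟩)

variable {hr : -r ≤ 0} {w₀ : Hist r m} {w w' : ℝ → Vec m}

theorem glue_of_nonneg {s : ℝ} (hs : 0 ≤ s) : glue hr w₀ w s = w s := by
  have : IccExtend hr w₀ s = w₀ ⟨0, hr, le_rfl⟩ := IccExtend_of_right_le hr w₀ hs
  rw [glue, this, max_eq_left hs, add_sub_cancel]

theorem glue_of_mem (h0 : w 0 = w₀ ⟨0, hr, le_rfl⟩) {s : ℝ} (hs : s ∈ Icc (-r) 0) :
    glue hr w₀ w s = w₀ ⟨s, hs⟩ := by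
  rw [glue, max_eq_right hs.2, h0, sub_self, add_zero, IccExtend_of_mem hr w₀ hs]

theorem continuousOn_glue {t : ℝ} (ht : 0 ≤ t) (hw : ContinuousOn w (Icc 0 t)) :
    ContinuousOn (glue hr w₀ w) (Iic t) := by
  refine (w₀.continuous.Icc_extend' (h := hr)).continuousOn.add (ContinuousOn.sub ?_
    continuousOn_const)
  exact hw.comp (by fun_prop) fun s hs => ⟨le_max_right _ _, max_le hs ht⟩

theorem norm_glue_le {t b : ℝ} (ht : 0 ≤ t) (hw : ∀ s ∈ Icc 0 t, ‖w s‖ ≤ b) {s : ℝ} (hs : s ≤ t) :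
    ‖glue hr w₀ w s‖ ≤ 2 * ‖w₀‖ + b := by
  have h1 := w₀.norm_coe_le_norm (projIcc (-r) 0 hr s)
  have h2 := w₀.norm_coe_le_norm ⟨0, hr, le_rfl⟩
  have h3 := hw (max s 0) ⟨le_max_right _ _, max_le hs ht⟩
  refine (norm_add_le _ _).trans ?_
  have h4 := norm_sub_le (w (max s 0)) (w₀ ⟨0, hr, le_rfl⟩)
  have h5 : ‖IccExtend hr w₀ s‖ ≤ ‖w₀‖ := h1
  linarith

theorem norm_glue_sub_le {t b : ℝ} (ht : 0 ≤ t) (hw : ∀ s ∈ Icc 0 t, ‖w s - w' s‖ ≤ b) {s : ℝ}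
    (hs : s ≤ t) : ‖glue hr w₀ w s - glue hr w₀ w' s‖ ≤ b := by
  have h3 := hw (max s 0) ⟨le_max_right _ _, max_le hs ht⟩
  rwa [glue, glue, add_sub_add_left_eq_sub, sub_sub_sub_cancel_right]

end Glue

/-! ### Well-posedness of the closed loop -/

section ClosedLoop

variable {n m : ℕ} {U : Set (Vec m)} {f : Vec n → Vec m → Vec n} {r : ℝ}
  {p g : Vec n → Hist r m → Vec m} {μ : ℝ}

/-- The right-hand side of the closed loop with initial history `w₀`. -/
noncomputable def loopRHS (U : Set (Vec m)) (f : Vec n → Vec m → Vec n)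
    (p g : Vec n → Hist r m → Vec m) (μ : ℝ) (hr : -r ≤ 0) (w₀ : Hist r m)
    (y : ℝ → Vec n × Vec m) (t : ℝ) : Vec n × Vec m :=
  (f (y t).1 (proj U (glue hr w₀ (fun s => (y s).2) (t - r))),
    g (y t).1 (history r (fun s => proj U (glue hr w₀ (fun s => (y s).2) s)) t) -
      μ • ((y t).2 -
        p (y t).1 (history r (fun s => proj U (glue hr w₀ (fun s => (y s).2) s)) t)))

/-- The initial history becomes a parameter, and only the values on `[0,t]` remain as unknowns.
Since `glue` is continuous even for data not matching `w₀` at `0`, the conditions hold for every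
continuous `y`, as the fixed point argument requires. -/
theorem isVolterra_loopRHS (hU : IsClosed U) (hc : Convex ℝ U) (h0 : (0 : Vec m) ∈ U)
    (hf : LocallyLipschitzOn (Set.univ ×ˢ U) (fun z : Vec n × Vec m => f z.1 z.2))
    {L : ℝ} (hL : 0 ≤ L) (hfGrowth : ∀ x : Vec n, ∀ u ∈ U, ‖f x u‖ ≤ L * ‖x‖ + L * ‖u‖)
    (hp : CompletelyLipschitz U r p) (hg : CompletelyLipschitz U r g)
    {G : ℝ} (hG : 0 ≤ G)
    (hpG : ∀ (x : Vec n) (φ : Hist r m), (∀ θ, φ θ ∈ U) → ‖p x φ‖ ≤ G * ‖x‖ + G * ‖φ‖)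
    (hgG : ∀ (x : Vec n) (φ : Hist r m), (∀ θ, φ θ ∈ U) → ‖g x φ‖ ≤ G * ‖x‖ + G * ‖φ‖)
    (hr : -r ≤ 0) (w₀ : Hist r m) : IsVolterra (loopRHS U f p g μ hr w₀) := by
  have hprojU : ∀ w, proj U w ∈ U := fun w => (proj_spec hU h0 w).1
  have hpc := continuous_proj hU hc h0
  have hucont : ∀ (y : ℝ → Vec n × Vec m) (t : ℝ), 0 ≤ t → ContinuousOn y (Icc 0 t) →
      ContinuousOn (fun s => proj U (glue hr w₀ (fun s => (y s).2) s)) (Icc (t - r) t) :=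
    fun y t ht hy => (hpc.comp_continuousOn (continuousOn_glue ht
      (continuous_snd.comp_continuousOn hy))).mono fun s hs => hs.2
  have hub : ∀ (y : ℝ → Vec n × Vec m) (t b : ℝ), 0 ≤ t → (∀ s ∈ Icc 0 t, ‖y s‖ ≤ b) →
      ∀ s ≤ t, ‖proj U (glue hr w₀ (fun s => (y s).2) s)‖ ≤ 2 * ‖w₀‖ + b :=
    fun y t b ht hy s hs => (norm_proj_le hU hc h0 _).trans
      (norm_glue_le ht (fun s hs => (norm_snd_le (y s)).trans (hy s hs)) hs)
  have hhU : ∀ (y : ℝ → Vec n × Vec m) (t : ℝ), 0 ≤ t → ContinuousOn y (Icc 0 t) →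
      ∀ θ, history r (fun s => proj U (glue hr w₀ (fun s => (y s).2) s)) t θ ∈ U := by
    intro y t ht hy θ
    rw [history_apply (hucont y t ht hy)]
    exact hprojU _
  refine ⟨fun y hy => ?_, ?_, fun B => ?_⟩
  · have hw : Continuous fun s => proj U (glue hr w₀ (fun s => (y s).2) s) := by
      refine hpc.comp ((w₀.continuous.Icc_extend' (h := hr)).add (Continuous.sub ?_
        continuous_const))
      exact (continuous_snd.comp hy).comp (by fun_prop)
    have hy1 : Continuous fun t => (y t).1 := continuous_fst.comp hy
    have hy2 : Continuous fun t => (y t).2 := continuous_snd.comp hy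
    refine Continuous.continuousOn (Continuous.prodMk ?_ ?_)
    · exact continuousOn_univ.1 (continuousOn_rhs hf.continuousOn hy1.continuousOn
        (hw.comp (by fun_prop : Continuous fun t : ℝ => t - r)).continuousOn
        fun t _ => hprojU _)
    · exact (hg.continuous_comp hy1 hw fun _ => hprojU _).sub
        ((hy2.sub (hp.continuous_comp hy1 hw fun _ => hprojU _)).const_smul μ)
  · refine ⟨2 * (L + G + |μ| * (1 + G)), ‖w₀‖, by positivity, norm_nonneg _,
      fun y t b ht hy hyb => ?_⟩
    have hb : 0 ≤ b := (norm_nonneg _).trans (hyb 0 ⟨le_rfl, ht⟩)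
    have hyt := hyb t ⟨ht, le_rfl⟩
    have hy1 := (norm_fst_le (y t)).trans hyt
    have hy2 := (norm_snd_le (y t)).trans hyt
    have hH := norm_history_le (by positivity) (hucont y t ht hy)
      fun s hs => hub y t b ht hyb s hs.2
    have h1 := hfGrowth (y t).1 _ (hprojU (glue hr w₀ (fun s => (y s).2) (t - r)))
    have h2 := hub y t b ht hyb (t - r) (by linarith)
    have h3 := hgG (y t).1 _ (hhU y t ht hy)
    have h4 := hpG (y t).1 _ (hhU y t ht hy)
    have hμ := abs_nonneg μ
    have hw := norm_nonneg w₀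
    rw [loopRHS, Prod.norm_mk]
    refine max_le ?_ ?_
    · calc _ ≤ _ := h1
        _ ≤ L * b + L * (2 * ‖w₀‖ + b) := by gcongr
        _ = 2 * L * (‖w₀‖ + b) := by ring
        _ ≤ _ := by
          gcongr
          nlinarith
    · refine (norm_sub_le _ _).trans ?_
      rw [norm_smul, Real.norm_eq_abs]
      calc _ ≤ (G * b + G * (2 * ‖w₀‖ + b)) + |μ| * (b + (G * b + G * (2 * ‖w₀‖ + b))) := by
            gcongr
            · exact h3.trans (by gcongr)
            · exact (norm_sub_le _ _).trans (add_le_add hy2 (h4.trans (by gcongr)))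
        _ = 2 * (G + |μ| * G) * (‖w₀‖ + b) + |μ| * b := by ring
        _ ≤ _ := by
          have := mul_nonneg hL hb
          have := mul_nonneg hL hw
          have := mul_nonneg hμ hb
          have := mul_nonneg hμ hw
          nlinarith
  · rcases lt_or_ge B 0 with hB | hB
    · refine ⟨0, le_rfl, fun y z t b ht _ _ hyB => absurd (hyB 0 ⟨le_rfl, ht⟩) ?_⟩
      exact not_le.2 (hB.trans_le (norm_nonneg _))
    -- `U` is closed and balls are compact, so local Lipschitz continuity of `f` becomes Lipschitz
    -- continuity on this compact set.
    obtain ⟨Kf, hKf⟩ := (hf.mono (s := Metric.closedBall 0 B ×ˢ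
      (Metric.closedBall 0 (2 * ‖w₀‖ + B) ∩ U))
      (prod_mono (subset_univ _) inter_subset_right)).exists_lipschitzOnWith_of_compact
      ((isCompact_closedBall _ _).prod ((isCompact_closedBall _ _).inter_right hU))
    let S : Set (Vec n × Hist r m) := {z | ‖z‖ ≤ 2 * ‖w₀‖ + B ∧ ∀ θ, z.2 θ ∈ U}
    have hS : Bornology.IsBounded S := isBounded_iff_forall_norm_le.2 ⟨_, fun z hz => hz.1⟩
    obtain ⟨Cp, hCp, hpS⟩ := hp S hS fun z hz => hz.2
    obtain ⟨Cg, hCg, hgS⟩ := hg S hS fun z hz => hz.2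
    refine ⟨Kf + 2 * Cg + |μ| * (1 + 2 * Cp), by positivity,
      fun y z t b ht hy hz hyB hzB hb => ?_⟩
    have hb0 : 0 ≤ b := (norm_nonneg _).trans (hb 0 ⟨le_rfl, ht⟩)
    have htt : t ∈ Icc 0 t := ⟨ht, le_rfl⟩
    have hd1 : ‖(y t).1 - (z t).1‖ ≤ b := (norm_fst_le (y t - z t)).trans (hb t htt)
    have hd2 : ‖(y t).2 - (z t).2‖ ≤ b := (norm_snd_le (y t - z t)).trans (hb t htt)
    have hud : ∀ s ≤ t, ‖proj U (glue hr w₀ (fun s => (y s).2) s) -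
        proj U (glue hr w₀ (fun s => (z s).2) s)‖ ≤ b := fun s hs =>
      (norm_proj_sub_proj_le hU hc h0 _ _).trans
        (norm_glue_sub_le ht (fun s hs => (norm_snd_le (y s - z s)).trans (hb s hs)) hs)
    have hH := norm_history_sub_le hb0 (hucont y t ht hy) (hucont z t ht hz)
      fun s hs => hud s hs.2
    have hmem : ∀ y : ℝ → Vec n × Vec m, ContinuousOn y (Icc 0 t) →
        (∀ s ∈ Icc 0 t, ‖y s‖ ≤ B) →
        ((y t).1, history r (fun s => proj U (glue hr w₀ (fun s => (y s).2) s)) t) ∈ S := by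
      intro y hy hyB
      refine ⟨?_, hhU y t ht hy⟩
      rw [Prod.norm_mk]
      refine max_le ?_ ?_
      · have := (norm_fst_le (y t)).trans (hyB t htt)
        linarith [norm_nonneg w₀]
      · exact norm_history_le (by positivity) (hucont y t ht hy)
          fun s hs => hub y t B ht hyB s hs.2
    have hmemf : ∀ y : ℝ → Vec n × Vec m, (∀ s ∈ Icc 0 t, ‖y s‖ ≤ B) →
        ((y t).1, proj U (glue hr w₀ (fun s => (y s).2) (t - r))) ∈
          (Metric.closedBall 0 B ×ˢ (Metric.closedBall 0 (2 * ‖w₀‖ + B) ∩ U) :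
            Set (Vec n × Vec m)) := by
      intro y hyB
      refine ⟨?_, ?_, hprojU _⟩
      · simpa using (norm_fst_le (y t)).trans (hyB t htt)
      · simpa using hub y t B ht hyB (t - r) (by linarith)
    have h1 := hKf.dist_le_mul _ (hmemf y hyB) _ (hmemf z hzB)
    rw [dist_eq_norm, dist_eq_norm, Prod.mk_sub_mk, Prod.norm_mk] at h1
    have h2 := hpS _ (hmem y hy hyB) _ (hmem z hz hzB)
    have h3 := hgS _ (hmem y hy hyB) _ (hmem z hz hzB)
    have hμ := abs_nonneg μ
    have hKf0 : (0 : ℝ) ≤ Kf := Kf.2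
    rw [loopRHS, loopRHS, Prod.mk_sub_mk, Prod.norm_mk]
    refine max_le ?_ ?_
    · calc _ ≤ _ := h1
        _ ≤ Kf * b := by
          gcongr
          exact max_le hd1 (hud _ (by linarith))
        _ ≤ _ := by
          gcongr
          have : 0 ≤ |μ| * (1 + 2 * Cp) := by positivity
          linarith
    · rw [sub_sub_sub_comm, ← smul_sub, sub_sub_sub_comm]
      refine (norm_sub_le _ _).trans ?_
      rw [norm_smul, Real.norm_eq_abs]
      calc _ ≤ (Cg * b + Cg * b) + |μ| * (b + (Cp * b + Cp * b)) := by
            gcongr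
            · exact h3.trans (by gcongr)
            · exact (norm_sub_le _ _).trans (add_le_add hd2 (h2.trans (by gcongr)))
        _ ≤ _ := by nlinarith [mul_nonneg hKf0 hb0]

theorem IsClosedLoopSolution.hasDerivWithinAt_loopRHS {hr : -r ≤ 0} {x₀ : Vec n} {w₀ : Hist r m}
    {a : ℝ} {x : ℝ → Vec n} {w : ℝ → Vec m}
    (h : IsClosedLoopSolution U f r p g μ x₀ w₀ (Ico 0 a) x w) {t : ℝ} (ht : t ∈ Ico 0 a) :
    HasDerivWithinAt (fun s => (x s, w s)) (loopRHS U f p g μ hr w₀ (fun s => (x s, w s)) t)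
      (Ico 0 a) t := by
  have heq : EqOn (fun s => proj U (w s)) (fun s => proj U (glue hr w₀ w s)) (Icc (t - r) t) := by
    intro s hs
    have : w s = glue hr w₀ w s := by
      rcases le_total 0 s with h0 | h0
      · exact (glue_of_nonneg h0).symm
      · have hs' : s ∈ Icc (-r) 0 := ⟨by linarith [hs.1, ht.1], h0⟩
        rw [glue_of_mem (h.initial_w ⟨0, hr, le_rfl⟩) hs']
        exact h.initial_w ⟨s, hs'⟩
    simp only [this]
  have h1 := h.eq_x t ht
  have h2 := h.eq_w t ht
  rw [history_congr heq] at h2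
  have h3 : proj U (w (t - r)) = proj U (glue hr w₀ w (t - r)) :=
    heq ⟨le_rfl, by linarith⟩
  simp only [h3] at h1
  exact h1.prodMk h2

theorem isClosedLoopSolution_of_loopRHS {hr : -r ≤ 0} {x₀ : Vec n} {w₀ : Hist r m}
    {y : ℝ → Vec n × Vec m} (hy0 : y 0 = (x₀, w₀ ⟨0, hr, le_rfl⟩))
    (hy : ∀ t, 0 ≤ t → HasDerivWithinAt y (loopRHS U f p g μ hr w₀ y t) (Ici 0) t) :
    IsClosedLoopSolution U f r p g μ x₀ w₀ (Ici 0) (fun s => (y s).1)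
      (glue hr w₀ fun s => (y s).2) where
  continuousOn := by
    have hyc : ContinuousOn y (Ici 0) := fun t ht => (hy t ht).continuousWithinAt
    have : ContinuousOn (glue hr w₀ fun s => (y s).2) univ := by
      refine (w₀.continuous.Icc_extend' (h := hr)).continuousOn.add (ContinuousOn.sub ?_
        continuousOn_const)
      exact (continuous_snd.comp_continuousOn hyc).comp (by fun_prop) fun s _ =>
        mem_Ici.2 (le_max_right _ _)
    exact this.mono (subset_univ _)
  initial_x := by rw [hy0]
  initial_w := fun θ => glue_of_mem (by rw [hy0]) θ.2
  eq_x := fun t ht => (hy t ht).fst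
  eq_w := fun t ht => by
    have h2 : HasDerivWithinAt (fun s => (y s).2) (loopRHS U f p g μ hr w₀ y t).2 (Ici 0) t :=
      (hy t ht).snd
    refine (h2.congr (fun s hs => glue_of_nonneg hs) (glue_of_nonneg ht)).congr_deriv ?_
    simp only [loopRHS]
    rw [glue_of_nonneg (mem_Ici.1 ht)]

theorem exists_unique_closedLoopSolution (hU : IsClosed U) (hc : Convex ℝ U)
    (h0 : (0 : Vec m) ∈ U)
    (hf : LocallyLipschitzOn (Set.univ ×ˢ U) (fun z : Vec n × Vec m => f z.1 z.2))
    {L : ℝ} (hL : 0 ≤ L) (hfGrowth : ∀ x : Vec n, ∀ u ∈ U, ‖f x u‖ ≤ L * ‖x‖ + L * ‖u‖)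
    (hp : CompletelyLipschitz U r p) (hg : CompletelyLipschitz U r g)
    {G : ℝ} (hG : 0 ≤ G)
    (hpG : ∀ (x : Vec n) (φ : Hist r m), (∀ θ, φ θ ∈ U) → ‖p x φ‖ ≤ G * ‖x‖ + G * ‖φ‖)
    (hgG : ∀ (x : Vec n) (φ : Hist r m), (∀ θ, φ θ ∈ U) → ‖g x φ‖ ≤ G * ‖x‖ + G * ‖φ‖)
    (hr : 0 ≤ r) (x₀ : Vec n) (w₀ : Hist r m) :
    ∃ (x : ℝ → Vec n) (w : ℝ → Vec m), IsClosedLoopSolution U f r p g μ x₀ w₀ (Ici 0) x w ∧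
      ∀ a : ℝ, 0 < a → ∀ (y : ℝ → Vec n) (z : ℝ → Vec m),
        IsClosedLoopSolution U f r p g μ x₀ w₀ (Ico 0 a) y z →
          EqOn y x (Ico 0 a) ∧ EqOn z w (Ico 0 a) := by
  have hr' : -r ≤ 0 := by linarith
  have hV := isVolterra_loopRHS (μ := μ) hU hc h0 hf hL hfGrowth hp hg hG hpG hgG hr' w₀
  obtain ⟨Y, hY0, hY⟩ := hV.exists_global (x₀, w₀ ⟨0, hr', le_rfl⟩)
  refine ⟨_, _, isClosedLoopSolution_of_loopRHS hY0 hY, fun a _ y z hyz => ?_⟩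
  have hE := hV.unique (fun t ht => hyz.hasDerivWithinAt_loopRHS ht)
    (fun t ht => (hY t ht.1).mono fun s hs => hs.1) (by
      rw [hY0, hyz.initial_x, ← hyz.initial_w ⟨0, hr', le_rfl⟩])
  refine ⟨fun t ht => congrArg Prod.fst (hE ht), fun t ht => ?_⟩
  rw [glue_of_nonneg ht.1]
  exact congrArg Prod.snd (hE ht)

end ClosedLoop

/-! ### Small-gain arguments for scalar bounds -/

section SmallGain

/-- The maximum `V` of the weighted `c` on a compact interval is finite by continuity, so no
boundedness of `a` is needed in advance. The two estimates combine to `V ≤ (X + A) + V / 2 + E`. -/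
theorem weighted_small_gain {a c : ℝ → ℝ} {r ω X A E γ ε : ℝ} (hω : 0 ≤ ω)
    (hA : 0 ≤ A) (hX : 0 ≤ X) (hγ : 0 ≤ γ) (hc0 : ∀ t, 0 ≤ t → 0 ≤ c t)
    (hcc : ContinuousOn c (Ici 0)) (haX : ∀ s ∈ Icc (-r) 0, a s ≤ X)
    (hgain : ∀ t, 0 ≤ t → ∀ b, (∀ τ ∈ Icc 0 t, Real.exp (ω * τ) * c τ ≤ b) →
      Real.exp (ω * t) * a t ≤ A + γ * b)
    (hv : ∀ t, 0 ≤ t → ∀ b, (∀ s ∈ Icc (t - r) t, a s ≤ b) →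
      Real.exp (ω * t) * c t ≤ ε * Real.exp (ω * t) * b + E)
    (hεγ : ε * Real.exp (ω * r) * γ ≤ 1 / 2) (hε1 : ε * Real.exp (ω * r) ≤ 1) {t : ℝ}
    (ht : 0 ≤ t) :
    Real.exp (ω * t) * c t ≤ 2 * (X + A + E) ∧
      Real.exp (ω * t) * a t ≤ A + γ * (2 * (X + A + E)) := by
  have key : ∀ T, 0 ≤ T → ∀ τ ∈ Icc 0 T, Real.exp (ω * τ) * c τ ≤ 2 * (X + A + E) := by
    intro T hT
    obtain ⟨τ, hτ, hmax⟩ := (isCompact_Icc (a := (0 : ℝ)) (b := T)).exists_isMaxOn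
      ⟨0, le_rfl, hT⟩ (f := fun t => Real.exp (ω * t) * c t)
      ((Continuous.continuousOn (by fun_prop)).mul (hcc.mono fun s hs => hs.1))
    set V := Real.exp (ω * τ) * c τ with hV
    have hV0 : 0 ≤ V := mul_nonneg (Real.exp_pos _).le (hc0 τ hτ.1)
    have hmax' : ∀ s ∈ Icc 0 T, Real.exp (ω * s) * c s ≤ V := fun s hs => hmax hs
    have hγV : 0 ≤ γ * V := by positivity
    have ha : ∀ s ∈ Icc (-r) T, Real.exp (ω * s) * a s ≤ X + A + γ * V := by
      intro s hs
      rcases le_total 0 s with h | h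
      · have := hgain s h V fun τ' hτ' => hmax' τ' ⟨hτ'.1, hτ'.2.trans hs.2⟩
        linarith
      · have h1 := haX s ⟨hs.1, h⟩
        have h2 : Real.exp (ω * s) ≤ 1 := Real.exp_le_one_iff.2 (by nlinarith)
        have h3 := mul_le_mul_of_nonneg_left h1 (Real.exp_pos (ω * s)).le
        have h4 := mul_le_mul_of_nonneg_right h2 hX
        linarith
    -- On the window `[τ - r, τ]` the inverse weight is at most `exp (ω (r - τ))`; this is the
    -- origin of the factor `exp (ω r)` in the smallness conditions.
    have h1 := hv τ hτ.1 (Real.exp (ω * (r - τ)) * (X + A + γ * V)) fun s hs => by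
      have h2 := ha s ⟨by linarith [hs.1, hτ.1], hs.2.trans hτ.2⟩
      have h3 : a s ≤ Real.exp (-(ω * s)) * (X + A + γ * V) := by
        have h4 := mul_le_mul_of_nonneg_left h2 (Real.exp_pos (-(ω * s))).le
        rwa [← mul_assoc, ← Real.exp_add, neg_add_cancel, Real.exp_zero, one_mul] at h4
      refine h3.trans (mul_le_mul_of_nonneg_right (Real.exp_le_exp.2 ?_) (by positivity))
      have := mul_le_mul_of_nonneg_left hs.1 hω
      linarith
    have h2 : ε * Real.exp (ω * τ) * (Real.exp (ω * (r - τ)) * (X + A + γ * V)) =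
        ε * Real.exp (ω * r) * (X + A) + ε * Real.exp (ω * r) * γ * V := by
      have : Real.exp (ω * r) = Real.exp (ω * τ) * Real.exp (ω * (r - τ)) := by
        rw [← Real.exp_add]; congr 1; ring
      rw [this]; ring
    rw [h2] at h1
    have h3 := mul_le_mul_of_nonneg_right hεγ hV0
    have h4 := mul_le_mul_of_nonneg_right hε1 (add_nonneg hX hA)
    intro τ' hτ'
    have := hmax' τ' hτ'
    linarith
  exact ⟨key t ht t ⟨ht, le_rfl⟩, hgain t ht _ (key t ht)⟩

/-- Once `a ≤ b` on a full delay window, `c` is at most `ε b` plus a decaying term. After waiting,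
`γ c` is below `b / 4 + b / 4` and the `σ` term below `b / 2`, so the bound halves. The waiting
times do not depend on `a` and `c`. -/
theorem uniform_decay {σ : ℝ → ℝ → ℝ} (hσ : IsKL σ) {r μ γ ε B E : ℝ} (hr : 0 ≤ r) (hμ : 0 < μ)
    (hεγ : ε * γ ≤ 1 / 4) (hB : 0 < B) (hE : 0 ≤ E) (N : ℕ) :
    ∃ T : ℝ, 0 ≤ T ∧ ∀ a c : ℝ → ℝ, (∀ t, 0 ≤ t → 0 ≤ a t) → (∀ t, 0 ≤ t → a t ≤ B) →
      (∀ t₀, 0 ≤ t₀ → ∀ t, t₀ ≤ t → ∀ b, (∀ τ ∈ Icc t₀ t, c τ ≤ b) →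
        a t ≤ max (σ (a t₀) (t - t₀)) (γ * b)) →
      (∀ t, 0 ≤ t → ∀ b, (∀ s ∈ Icc (t - r) t, a s ≤ b) → c t ≤ ε * b + E * Real.exp (-μ * t)) →
      ∀ t, T ≤ t → a t ≤ B / 2 ^ N := by
  induction N with
  | zero => exact ⟨0, le_rfl, fun a c _ haB _ _ t ht => by simpa using haB t ht⟩
  | succ N ih =>
    obtain ⟨T, hT, ih⟩ := ih
    set b := B / 2 ^ N with hb
    have hb0 : 0 < b := by positivity
    have hexp : Tendsto (fun t => γ * (E * Real.exp (-μ * t))) atTop (𝓝 0) := by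
      have h1 : Tendsto (fun t : ℝ => Real.exp (-μ * t)) atTop (𝓝 0) := by
        refine Real.tendsto_exp_atBot.comp ?_
        exact (tendsto_id.const_mul_atTop_of_neg (neg_lt_zero.2 hμ))
      simpa using (h1.const_mul E).const_mul γ
    obtain ⟨T₁, hT₁⟩ := eventually_atTop.1
      (hexp.eventually (eventually_le_nhds (by positivity : (0 : ℝ) < b / 4)))
    obtain ⟨T₂, hT₂⟩ := eventually_atTop.1
      ((hσ.tendsto b hb0.le).eventually (eventually_le_nhds (by positivity : (0 : ℝ) < b / 2)))
    -- The extra `r` places the whole window `[τ - r, τ]` after `T` for every `τ ≥ T'`.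
    set T' := max (T + r) T₁ with hT'
    have hT'T : T + r ≤ T' := le_max_left _ _
    refine ⟨T' + max T₂ 0, by positivity, fun a c ha0 haB hiss hv t ht => ?_⟩
    have hsmall := ih a c ha0 haB hiss hv
    have ht' : T' ≤ t := by linarith [le_max_right T₂ 0]
    have hc : ∀ τ ∈ Icc T' t, c τ ≤ ε * b + E * Real.exp (-μ * T') := by
      intro τ hτ
      have h1 := hv τ (by linarith [hτ.1]) b fun s hs => hsmall s (by linarith [hs.1, hτ.1])
      have h2 : Real.exp (-μ * τ) ≤ Real.exp (-μ * T') :=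
        Real.exp_le_exp.2 (by nlinarith [hτ.1])
      have h3 := mul_le_mul_of_nonneg_left h2 hE
      linarith
    have hT'0 : 0 ≤ T' := by linarith
    have hbN : B / 2 ^ (N + 1) = b / 2 := by rw [hb, pow_succ]; field_simp
    rw [hbN]
    refine (hiss T' hT'0 t ht' _ hc).trans (max_le ?_ ?_)
    · have h1 : σ (a T') (t - T') ≤ σ b (t - T') :=
        (hσ.strictMonoOn (t - T') (by linarith)).monotoneOn (ha0 T' hT'0) hb0.le
          (hsmall T' (by linarith))
      exact h1.trans (hT₂ _ (by linarith [le_max_left T₂ 0]))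
    · have h1 := hT₁ T' (le_max_right _ _)
      have h2 := mul_le_mul_of_nonneg_right hεγ hb0.le
      linarith

end SmallGain

/-! ### A continuous `KL` majorant for a family of data -/

section KLMajorant

/-- The truncation of `p` to `[0,1]`. -/
noncomputable def clamp (p : ℝ) : ℝ := max 0 (min 1 p)

theorem clamp_nonneg (p : ℝ) : 0 ≤ clamp p := le_max_left _ _

theorem clamp_le_one (p : ℝ) : clamp p ≤ 1 := max_le zero_le_one (min_le_left _ _)

theorem clamp_of_one_le {p : ℝ} (h : 1 ≤ p) : clamp p = 1 := by
  rw [clamp, min_eq_left h, max_eq_right zero_le_one]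

theorem clamp_of_nonpos {p : ℝ} (h : p ≤ 0) : clamp p = 0 := by
  rw [clamp, min_eq_right (h.trans zero_le_one), max_eq_left h]

theorem clamp_mono {p q : ℝ} (h : p ≤ q) : clamp p ≤ clamp q :=
  max_le_max le_rfl (min_le_min le_rfl h)

theorem clamp_sub_le (p q : ℝ) : clamp p - clamp q ≤ |p - q| := by
  have := abs_nonneg (p - q)
  have := le_abs_self (p - q)
  simp only [clamp, max_def, min_def]
  split_ifs <;> linarith

variable {ι : Type*} {a θ y : ι → ℝ} {α : ℝ → ℝ}

/-- An upper envelope of the data `y i` at the points `(a i, θ i)`, smoothed to be continuous. -/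
noncomputable def envelope (a θ y : ι → ℝ) (s t : ℝ) : ℝ :=
  ⨆ i, y i * (clamp (2 * s / a i - 1) * clamp (1 + θ i - t))

theorem envelope_term_nonneg (hy : ∀ i, 0 ≤ y i) (s t : ℝ) (i : ι) :
    0 ≤ y i * (clamp (2 * s / a i - 1) * clamp (1 + θ i - t)) :=
  mul_nonneg (hy i) (mul_nonneg (clamp_nonneg _) (clamp_nonneg _))

theorem envelope_nonneg (hy : ∀ i, 0 ≤ y i) (s t : ℝ) : 0 ≤ envelope a θ y s t :=
  Real.iSup_nonneg (envelope_term_nonneg hy s t)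

theorem envelope_term_le_left (hy : ∀ i, 0 ≤ y i) (s t : ℝ) (i : ι) :
    y i * (clamp (2 * s / a i - 1) * clamp (1 + θ i - t)) ≤ y i :=
  mul_le_of_le_one_right (hy i) (mul_le_one₀ (clamp_le_one _) (clamp_nonneg _) (clamp_le_one _))

theorem envelope_term_eq_zero (ha : ∀ i, 0 ≤ a i) {s t : ℝ} {i : ι} (h : 2 * s < a i) :
    y i * (clamp (2 * s / a i - 1) * clamp (1 + θ i - t)) = 0 := by
  have h1 : clamp (2 * s / a i - 1) = 0 := by
    refine clamp_of_nonpos (sub_nonpos.2 ?_)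
    exact div_le_one_of_le₀ h.le (ha i)
  rw [h1, zero_mul, mul_zero]

theorem envelope_term_le (hα : MonotoneOn α (Ici 0)) (hα0 : α 0 = 0) (ha : ∀ i, 0 ≤ a i)
    (hy : ∀ i, 0 ≤ y i) (hyα : ∀ i, y i ≤ α (a i)) {s : ℝ} (hs : 0 ≤ s) (t : ℝ) (i : ι) :
    y i * (clamp (2 * s / a i - 1) * clamp (1 + θ i - t)) ≤ α (2 * s) := by
  have h2s : (2 * s) ∈ Ici (0 : ℝ) := mem_Ici.2 (by positivity)
  rcases lt_or_ge (2 * s) (a i) with h | h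
  · rw [envelope_term_eq_zero ha h, ← hα0]
    exact hα self_mem_Ici h2s h2s
  · exact (envelope_term_le_left hy s t i).trans ((hyα i).trans (hα (ha i) h2s h))

theorem envelope_bddAbove (hα : MonotoneOn α (Ici 0)) (hα0 : α 0 = 0) (ha : ∀ i, 0 ≤ a i)
    (hy : ∀ i, 0 ≤ y i) (hyα : ∀ i, y i ≤ α (a i)) {s : ℝ} (hs : 0 ≤ s) (t : ℝ) :
    BddAbove (range fun i => y i * (clamp (2 * s / a i - 1) * clamp (1 + θ i - t))) :=
  ⟨α (2 * s), by rintro _ ⟨i, rfl⟩; exact envelope_term_le hα hα0 ha hy hyα hs t i⟩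

theorem envelope_le (hα : MonotoneOn α (Ici 0)) (hα0 : α 0 = 0) (ha : ∀ i, 0 ≤ a i)
    (hy : ∀ i, 0 ≤ y i) (hyα : ∀ i, y i ≤ α (a i)) {s : ℝ} (hs : 0 ≤ s) (t : ℝ) :
    envelope a θ y s t ≤ α (2 * s) := by
  refine Real.iSup_le (envelope_term_le hα hα0 ha hy hyα hs t) ?_
  rw [← hα0]
  exact hα self_mem_Ici (mem_Ici.2 (by positivity)) (by positivity)

theorem envelope_mono (hα : MonotoneOn α (Ici 0)) (hα0 : α 0 = 0) (ha : ∀ i, 0 ≤ a i)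
    (hy : ∀ i, 0 ≤ y i) (hyα : ∀ i, y i ≤ α (a i)) {s s' t t' : ℝ} (hs : 0 ≤ s) (hss : s ≤ s')
    (htt : t' ≤ t) : envelope a θ y s t ≤ envelope a θ y s' t' := by
  refine Real.iSup_le (fun i => ?_) (envelope_nonneg hy _ _)
  refine le_trans ?_ (le_ciSup (envelope_bddAbove hα hα0 ha hy hyα (hs.trans hss) t') i)
  have h1 : clamp (2 * s / a i - 1) ≤ clamp (2 * s' / a i - 1) :=
    clamp_mono (by have := ha i; gcongr)
  have h2 : clamp (1 + θ i - t) ≤ clamp (1 + θ i - t') := clamp_mono (by linarith)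
  exact mul_le_mul_of_nonneg_left
    (mul_le_mul h1 h2 (clamp_nonneg _) (clamp_nonneg _)) (hy i)

/-- Both cutoffs equal one at the point `(a i, θ i)` when `a i > 0`. When `a i = 0`, the bound `α 0
= 0` forces `y i ≤ 0`. -/
theorem le_envelope (hα : MonotoneOn α (Ici 0)) (hα0 : α 0 = 0) (ha : ∀ i, 0 ≤ a i)
    (hy : ∀ i, 0 ≤ y i) (hyα : ∀ i, y i ≤ α (a i)) (i : ι) :
    y i ≤ envelope a θ y (a i) (θ i) := by
  rcases (ha i).eq_or_lt with h | h
  · have := hyα i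
    rw [← h, hα0] at this
    exact this.trans (envelope_nonneg hy _ _)
  · refine le_trans (le_of_eq ?_) (le_ciSup (envelope_bddAbove hα hα0 ha hy hyα (ha i) (θ i)) i)
    rw [clamp_of_one_le, clamp_of_one_le (by linarith), mul_one, mul_one]
    rw [mul_div_assoc, div_self h.ne']
    norm_num

/-- A Lipschitz bound uniform in `i`, away from `s = 0`. For `a i < s₀ / 2` the cutoff in `s` is
locally constant, otherwise its slope `2 / a i` is at most `4 / s₀`; terms with `a i > 4 s₀` vanish
and the others have `y i ≤ α (4 s₀)`. -/
theorem envelope_sub_le (hα : MonotoneOn α (Ici 0)) (hα0 : α 0 = 0) (ha : ∀ i, 0 ≤ a i)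
    (hy : ∀ i, 0 ≤ y i) (hyα : ∀ i, y i ≤ α (a i)) {s₀ : ℝ} (hs₀ : 0 < s₀) {s s' : ℝ}
    (hs : s ∈ Icc (s₀ / 2) (2 * s₀)) (hs' : s' ∈ Icc (s₀ / 2) (2 * s₀)) (t t' : ℝ) :
    envelope a θ y s t - envelope a θ y s' t' ≤
      α (4 * s₀) * (4 / s₀ * |s - s'| + |t - t'|) := by
  have h4 : (4 * s₀) ∈ Ici (0 : ℝ) := mem_Ici.2 (by positivity)
  have hα4 : 0 ≤ α (4 * s₀) := by rw [← hα0]; exact hα self_mem_Ici h4 h4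
  have hs'0 : 0 ≤ s' := by linarith [hs'.1]
  rw [sub_le_iff_le_add']
  refine Real.iSup_le (fun i => ?_) (add_nonneg (envelope_nonneg hy _ _) (by positivity))
  refine le_trans ?_ (add_le_add_left
    (le_ciSup (envelope_bddAbove hα hα0 ha hy hyα hs'0 t') i) _)
  rw [← sub_le_iff_le_add', ← mul_sub]
  set C := clamp (2 * s / a i - 1) with hC
  set C' := clamp (2 * s' / a i - 1) with hC'
  set D := clamp (1 + θ i - t) with hD
  set D' := clamp (1 + θ i - t') with hD'
  have hDD : D - D' ≤ |t - t'| := by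
    refine (clamp_sub_le _ _).trans (le_of_eq ?_)
    rw [← abs_neg]; congr 1; ring
  have hCC : C - C' ≤ 4 / s₀ * |s - s'| := by
    rcases lt_or_ge (a i) (s₀ / 2) with h | h
    · have : C - C' = 0 := by
        rcases (ha i).eq_or_lt with h0 | h0
        · rw [hC, hC', ← h0, div_zero, div_zero, sub_self]
        · have hone : ∀ σ, s₀ / 2 ≤ σ → clamp (2 * σ / a i - 1) = 1 := by
            intro σ hσ
            refine clamp_of_one_le ?_
            rw [le_sub_iff_add_le, le_div_iff₀ h0]
            linarith
          rw [hC, hC', hone s hs.1, hone s' hs'.1, sub_self]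
      rw [this]
      positivity
    · have h0 : 0 < a i := by linarith
      refine (clamp_sub_le _ _).trans ?_
      have e : 2 * s / a i - 1 - (2 * s' / a i - 1) = 2 / a i * (s - s') := by ring
      rw [e, abs_mul, abs_of_nonneg (by positivity)]
      refine mul_le_mul_of_nonneg_right ?_ (abs_nonneg _)
      rw [div_le_div_iff₀ h0 hs₀]
      linarith
  have hsum : C * D - C' * D' ≤ 4 / s₀ * |s - s'| + |t - t'| := by
    have hp : 0 ≤ 4 / s₀ * |s - s'| := by positivity
    have e : C * D - C' * D' = (C - C') * D + C' * (D - D') := by ring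
    have h1 : (C - C') * D ≤ 4 / s₀ * |s - s'| := by
      have := mul_le_mul_of_nonneg_right hCC (clamp_nonneg (1 + θ i - t))
      have := mul_le_of_le_one_right hp (clamp_le_one (1 + θ i - t))
      linarith
    have h2 : C' * (D - D') ≤ |t - t'| := by
      have := mul_le_mul_of_nonneg_left hDD (clamp_nonneg (2 * s' / a i - 1))
      have := mul_le_of_le_one_left (abs_nonneg (t - t')) (clamp_le_one (2 * s' / a i - 1))
      linarith
    linarith
  rcases lt_or_ge (4 * s₀) (a i) with h | h
  · have e1 := envelope_term_eq_zero (y := y) (θ := θ) (t := t) ha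
      (by linarith [hs.2] : 2 * s < a i)
    have e2 := envelope_term_eq_zero (y := y) (θ := θ) (t := t') ha
      (by linarith [hs'.2] : 2 * s' < a i)
    rw [mul_sub, e1, e2, sub_self]
    positivity
  · calc y i * (C * D - C' * D') ≤ y i * (4 / s₀ * |s - s'| + |t - t'|) :=
        mul_le_mul_of_nonneg_left hsum (hy i)
      _ ≤ _ := mul_le_mul_of_nonneg_right ((hyα i).trans (hα (ha i) h4 h)) (by positivity)

/-- At `s = 0` the envelope is squeezed by `α (2 s)`; elsewhere it is locally Lipschitz. -/
theorem continuousOn_envelope (hα : MonotoneOn α (Ici 0)) (hα0 : α 0 = 0)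
    (hαc : ContinuousOn α (Ici 0)) (ha : ∀ i, 0 ≤ a i)
    (hy : ∀ i, 0 ≤ y i) (hyα : ∀ i, y i ≤ α (a i)) :
    ContinuousOn (fun z : ℝ × ℝ => envelope a θ y z.1 z.2) (Ici 0 ×ˢ Ici 0) := by
  rintro ⟨s₀, t₀⟩ ⟨hs₀, ht₀⟩
  rcases (mem_Ici.1 hs₀).eq_or_lt with h | h
  · have h : s₀ = 0 := h.symm
    subst h
    have hval : envelope a θ y 0 t₀ = 0 := by
      refine le_antisymm ?_ (envelope_nonneg hy _ _)
      simpa [hα0] using envelope_le (θ := θ) hα hα0 ha hy hyα le_rfl t₀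
    have h1 : ContinuousWithinAt (fun z : ℝ × ℝ => α (2 * z.1)) (Ici 0 ×ˢ Ici 0) (0, t₀) := by
      have : ContinuousOn (fun z : ℝ × ℝ => α (2 * z.1)) (Ici 0 ×ˢ Ici 0) :=
        hαc.comp (by fun_prop) fun z hz => mem_Ici.2 (by have := mem_Ici.1 hz.1; positivity)
      exact this _ ⟨self_mem_Ici, ht₀⟩
    rw [ContinuousWithinAt] at h1 ⊢
    simp only [mul_zero, hα0] at h1
    rw [hval]
    refine squeeze_zero' (Eventually.of_forall fun z => envelope_nonneg hy _ _) ?_ h1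
    filter_upwards [self_mem_nhdsWithin] with z hz
    exact envelope_le hα hα0 ha hy hyα hz.1 z.2
  · refine ContinuousAt.continuousWithinAt ?_
    rw [ContinuousAt, tendsto_iff_dist_tendsto_zero]
    have hlim : Tendsto (fun z : ℝ × ℝ => α (4 * s₀) * (4 / s₀ * |z.1 - s₀| + |z.2 - t₀|))
        (𝓝 (s₀, t₀)) (𝓝 0) := by
      have : Continuous fun z : ℝ × ℝ => α (4 * s₀) * (4 / s₀ * |z.1 - s₀| + |z.2 - t₀|) := by
        fun_prop
      simpa using this.tendsto (s₀, t₀)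
    refine squeeze_zero' (Eventually.of_forall fun _ => dist_nonneg) ?_ hlim
    have hev : ∀ᶠ z : ℝ × ℝ in 𝓝 (s₀, t₀), z.1 ∈ Icc (s₀ / 2) (2 * s₀) :=
      (continuous_fst.tendsto (s₀, t₀)).eventually
        (Icc_mem_nhds (by simp only; linarith) (by simp only; linarith))
    filter_upwards [hev] with z hz
    have hz₀ : s₀ ∈ Icc (s₀ / 2) (2 * s₀) := ⟨by linarith, by linarith⟩
    rw [Real.dist_eq]
    refine abs_sub_le_iff.2 ⟨envelope_sub_le hα hα0 ha hy hyα h hz hz₀ _ _, ?_⟩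
    have := envelope_sub_le (θ := θ) hα hα0 ha hy hyα h hz₀ hz t₀ z.2
    rwa [abs_sub_comm s₀, abs_sub_comm t₀] at this

/-- The envelope is continuous with the required weak monotonicity, and adding `s * exp (-t)` makes
it strictly increasing in `s`. It tends to zero because at `(s,t)` only data with `a i ≤ 2 s` and `θ
i > t - 1` contribute, and `hdecay` is uniform over these. -/
theorem exists_isKL_majorant (hα : MonotoneOn α (Ici 0)) (hα0 : α 0 = 0)
    (hαc : ContinuousOn α (Ici 0)) (ha : ∀ i, 0 ≤ a i)
    (hy : ∀ i, 0 ≤ y i) (hyα : ∀ i, y i ≤ α (a i))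
    (hdecay : ∀ M δ : ℝ, 0 < δ → ∃ T : ℝ, ∀ i, a i ≤ M → T ≤ θ i → y i ≤ δ) :
    ∃ β : ℝ → ℝ → ℝ, IsKL β ∧ ∀ i, y i ≤ β (a i) (θ i) := by
  refine ⟨fun s t => envelope a θ y s t + s * Real.exp (-t), ⟨?_, ?_, ?_, ?_, ?_⟩, fun i => ?_⟩
  · exact (continuousOn_envelope hα hα0 hαc ha hy hyα).add
      (Continuous.continuousOn (by fun_prop))
  · intro t _
    have : envelope a θ y 0 t ≤ 0 := by
      simpa [hα0] using envelope_le (θ := θ) hα hα0 ha hy hyα le_rfl t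
    simp [le_antisymm this (envelope_nonneg hy _ _)]
  · intro t _ s hs s' _ hss
    exact add_lt_add_of_le_of_lt (envelope_mono hα hα0 ha hy hyα hs hss.le le_rfl)
      (mul_lt_mul_of_pos_right hss (Real.exp_pos _))
  · intro s hs t _ t' _ htt
    exact add_le_add (envelope_mono hα hα0 ha hy hyα hs le_rfl htt)
      (mul_le_mul_of_nonneg_left (Real.exp_le_exp.2 (by linarith)) hs)
  · intro s hs
    have h1 : Tendsto (fun t => s * Real.exp (-t)) atTop (𝓝 0) := by
      simpa using Real.tendsto_exp_neg_atTop_nhds_zero.const_mul s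
    have h2 : Tendsto (fun t => envelope a θ y s t) atTop (𝓝 0) := by
      refine tendsto_order.2 ⟨fun x hx => Eventually.of_forall fun t =>
        hx.trans_le (envelope_nonneg hy _ _), fun δ hδ => ?_⟩
      obtain ⟨T, hT⟩ := hdecay (2 * s) (δ / 2) (by positivity)
      filter_upwards [eventually_ge_atTop (T + 1)] with t ht
      refine lt_of_le_of_lt (Real.iSup_le (fun i => ?_) (by positivity)) (half_lt_self hδ)
      rcases lt_or_ge (2 * s) (a i) with h | h
      · rw [envelope_term_eq_zero ha h]; positivity
      rcases lt_or_ge (θ i) T with h' | h'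
      · rw [clamp_of_nonpos (p := 1 + θ i - t) (by linarith), mul_zero, mul_zero]; positivity
      · exact (envelope_term_le_left hy s t i).trans (hT i h h')
    simpa using h2.add h1
  · have := le_envelope (θ := θ) hα hα0 ha hy hyα i
    have := mul_nonneg (ha i) (Real.exp_pos (-θ i)).le
    linarith

end KLMajorant

/-! ### Integral form and the linear error equation -/

section Calculus

variable {E : Type*} [NormedAddCommGroup E] [NormedSpace ℝ E]

theorem eq_add_integral_of_hasDerivWithinAt [CompleteSpace E] {x F : ℝ → E}
    (hx : ∀ t, 0 ≤ t → HasDerivWithinAt x (F t) (Ici 0) t) (hF : ContinuousOn F (Ici 0))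
    {t τ : ℝ} (ht : 0 ≤ t) (hτ : 0 ≤ τ) :
    x (t + τ) = x t + ∫ σ in (0 : ℝ)..τ, F (t + σ) := by
  have hsub : Icc t (t + τ) ⊆ Ici 0 := fun s hs => ht.trans hs.1
  have h1 := intervalIntegral.integral_eq_sub_of_hasDeriv_right_of_le (f := x) (f' := F)
    (by linarith : t ≤ t + τ) (fun s hs => ((hx s (hsub hs)).continuousWithinAt).mono hsub)
    (fun s hs => (hx s (ht.trans hs.1.le)).mono fun s' hs' =>
      (ht.trans hs.1.le).trans (mem_Ioi.1 hs').le)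
    ((hF.mono (by rw [uIcc_of_le (by linarith)]; exact hsub)).intervalIntegrable)
  have h2 := intervalIntegral.integral_comp_add_left F t (a := 0) (b := τ)
  rw [h2, add_zero, h1]
  abel

theorem eq_exp_smul_of_hasDerivWithinAt {e : ℝ → E} {μ : ℝ}
    (he : ∀ t, 0 ≤ t → HasDerivWithinAt e (-(μ • e t)) (Ici 0) t) {t : ℝ} (ht : 0 ≤ t) :
    e t = Real.exp (-μ * t) • e 0 := by
  have hd : ∀ s, 0 ≤ s → HasDerivWithinAt (fun s => Real.exp (μ * s) • e s) 0 (Ici 0) s := by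
    intro s hs
    have h1 : HasDerivAt (fun s => Real.exp (μ * s)) (Real.exp (μ * s) * μ) s := by
      simpa using ((hasDerivAt_id s).const_mul μ).exp
    refine (h1.hasDerivWithinAt.smul (he s hs)).congr_deriv ?_
    rw [smul_neg, smul_smul, neg_add_cancel]
  have h := constant_of_has_deriv_right_zero (a := 0) (b := t)
    (fun s hs => (hd s hs.1).continuousWithinAt.mono fun s' hs' => hs'.1)
    (fun s hs => (hd s hs.1).mono (Ici_subset_Ici.2 hs.1)) t ⟨ht, le_rfl⟩
  simp only [mul_zero, Real.exp_zero, one_smul] at h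
  rw [← h, smul_smul, ← Real.exp_add]
  simp

end Calculus

/-! ### The shifted input -/

section DelayShift

variable {m : ℕ} {r : ℝ}

theorem delayShift_mem {U : Set (Vec m)} (h0 : (0 : Vec m) ∈ U) {φ : Hist r m}
    (hφ : ∀ θ, φ θ ∈ U) (s : ℝ) : delayShift φ s ∈ U := by
  unfold delayShift
  split_ifs
  · exact hφ _
  · exact h0

theorem norm_delayShift_le (φ : Hist r m) (s : ℝ) : ‖delayShift φ s‖ ≤ ‖φ‖ := by
  unfold delayShift
  split_ifs
  · exact φ.norm_coe_le_norm _
  · simp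

theorem delayShift_of_mem (φ : Hist r m) {s : ℝ} (hs : s ∈ Icc 0 r) :
    delayShift φ s = φ ⟨s - r, by linarith [hs.1], by linarith [hs.2]⟩ := by
  have hs' : s - r ∈ Icc (-r) 0 := ⟨by linarith [hs.1], by linarith [hs.2]⟩
  unfold delayShift
  rw [dif_pos hs']

theorem continuousOn_delayShift (hr : 0 ≤ r) (φ : Hist r m) :
    ContinuousOn (delayShift φ) (Icc 0 r) := by
  have hr' : -r ≤ 0 := by linarith
  have h1 : Continuous fun s => IccExtend hr' φ (s - r) :=
    (φ.continuous.Icc_extend' (h := hr')).comp (by fun_prop : Continuous fun s : ℝ => s - r)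
  refine h1.continuousOn.congr fun s hs => ?_
  rw [delayShift_of_mem φ hs]
  exact (IccExtend_of_mem hr' φ _).symm

end DelayShift

/-! ### Reduction of the closed loop to the perturbed delay-free system -/

section LoopBounds

variable {n m : ℕ} {U : Set (Vec m)} {f : Vec n → Vec m → Vec n} {k : Vec n → Vec m} {r : ℝ}

/-- The properties of a solution `(x,w)` of the closed loop from which the decay estimates follow:
`t ↦ x (t + r)` solves the delay-free system with the perturbation `v t = w t - k (x (t + r))`, and
`v` is small compared to `x` up to an exponentially decaying term. -/
structure LoopBounds (U : Set (Vec m)) (f : Vec n → Vec m → Vec n) (k : Vec n → Vec m)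
    (r R μ δ C s₀ : ℝ) (x : ℝ → Vec n) (w : ℝ → Vec m) : Prop where
  x_le : ∀ t ∈ Icc 0 r, ‖x t‖ ≤ C * s₀
  continuousOn_v : ContinuousOn (fun t => w t - k (x (t + r))) (Ici 0)
  isInput : ∀ t₀, 0 ≤ t₀ → IsInput (fun t => w (t + t₀) - k (x (t + t₀ + r)))
  perturbed : ∀ t₀, 0 ≤ t₀ → IsPerturbedSolution U f k
    (fun t => w (t + t₀) - k (x (t + t₀ + r))) (fun t => x (t + t₀ + r))
  v_le : ∀ t, 0 ≤ t → ∀ b, (∀ s ∈ Icc t (t + r), ‖x s‖ ≤ b) →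
    ‖w t - k (x (t + r))‖ ≤ δ * b + C * s₀ * Real.exp (-μ * t)
  w_le : ∀ t, 0 ≤ t → ‖w t‖ ≤ ‖w t - k (x (t + r))‖ + R * ‖x (t + r)‖

theorem isInput_of_continuousOn {v : ℝ → Vec m} (hv : ContinuousOn v (Ici 0)) : IsInput v := by
  refine ⟨hv.aemeasurable measurableSet_Ici, fun T => ?_⟩
  obtain ⟨B, -, hB⟩ := exists_norm_le_Icc (hv.mono (Icc_subset_Ici_self : Icc 0 T ⊆ Ici 0))
  exact ⟨B, ae_restrict_of_forall_mem measurableSet_Icc hB⟩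

theorem IsDelaySolution.norm_le {L : ℝ} (hL : 0 ≤ L)
    (hfGrowth : ∀ x : Vec n, ∀ u ∈ U, ‖f x u‖ ≤ L * ‖x‖ + L * ‖u‖)
    {u : ℝ → Vec m} (huU : ∀ t, u t ∈ U) {x : ℝ → Vec n} (hx : IsDelaySolution f r (Ici 0) u x)
    {s₀ : ℝ} (hx0 : ‖x 0‖ ≤ s₀) (hus : ∀ t ∈ Icc (-r) 0, ‖u t‖ ≤ s₀) {t : ℝ} (ht : t ∈ Icc 0 r) :
    ‖x t‖ ≤ 2 * Real.exp ((L + 1) * r) * s₀ := by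
  have hs0 : 0 ≤ s₀ := (norm_nonneg _).trans hx0
  -- The rate `L + 1` instead of `L` avoids the degenerate case of rate zero and cancels in the
  -- inhomogeneous term.
  have h := norm_le_gronwallBound_of_norm_deriv_right_le (f := x)
    (f' := fun t => f (x t) (u (t - r))) (δ := s₀) (K := L + 1) (ε := (L + 1) * s₀) (a := 0)
    (b := r) (fun t ht => (hx t ht.1).continuousWithinAt.mono fun s hs => hs.1)
    (fun t ht => (hx t ht.1).mono (Ici_subset_Ici.2 ht.1)) hx0
    (fun t ht => by
      have h1 := hfGrowth (x t) _ (huU (t - r))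
      have h2 := mul_le_mul_of_nonneg_left
        (hus (t - r) ⟨by linarith [ht.1], by linarith [ht.2]⟩) hL
      have := norm_nonneg (x t)
      linarith) t ht
  have hL1 : L + 1 ≠ 0 := by positivity
  rw [gronwallBound_of_K_ne_0 hL1, mul_div_cancel_left₀ _ hL1, sub_zero] at h
  have h1 : Real.exp ((L + 1) * t) ≤ Real.exp ((L + 1) * r) :=
    Real.exp_le_exp.2 (mul_le_mul_of_nonneg_left ht.2 (by positivity))
  have h2 := mul_le_mul_of_nonneg_left h1 hs0
  linarith

/-- In the constant, the exponential bounds `x` on `[0,r]`, where the input is given by the initial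
history; `1 + R * C₁` bounds the initial mismatch `w 0 - p`. -/
theorem IsClosedLoopSolution.loopBounds (hr : 0 ≤ r) (hU : IsClosed U) (hc : Convex ℝ U)
    (h0 : (0 : Vec m) ∈ U)
    (hf : ContinuousOn (fun z : Vec n × Vec m => f z.1 z.2) (univ ×ˢ U))
    {L : ℝ} (hL : 0 ≤ L)
    (hfGrowth : ∀ x : Vec n, ∀ u ∈ U, ‖f x u‖ ≤ L * ‖x‖ + L * ‖u‖)
    {R : ℝ} (hR : 0 ≤ R) (hkc : Continuous k) (hkR : ∀ x y, ‖k x - k y‖ ≤ R * ‖x - y‖)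
    (hk0 : k 0 = 0) {q l : ℕ} {δ C₁ : ℝ} (hC₁ : 0 ≤ C₁)
    (hP : ∀ (u : ℝ → Vec m) (x : Vec n) (b : ℝ), 0 ≤ b → (∀ t, u t ∈ U) →
      (∀ t, ‖u t‖ ≤ b) → ‖flowApprox f r l q u x‖ ≤ C₁ * (‖x‖ + b))
    (hPx : ∀ (u : ℝ → Vec m) (ξ : ℝ → Vec n) (B : ℝ), ContinuousOn u (Icc 0 r) →
        (∀ t, u t ∈ U) → ContinuousOn ξ (Icc 0 r) →
        (∀ t ∈ Icc 0 r, ξ t = ξ 0 + ∫ τ in (0 : ℝ)..t, f (ξ τ) (u τ)) →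
        (∀ t ∈ Icc 0 r, ‖ξ t‖ ≤ B) → ‖flowApprox f r l q u (ξ 0) - ξ r‖ ≤ δ * B)
    {g : Vec n → Hist r m → Vec m} (hg : IsDerivativePair U f r (predictor f k r l q) g)
    {μ : ℝ} {x₀ : Vec n} {w₀ : Hist r m} {x : ℝ → Vec n} {w : ℝ → Vec m}
    (h : IsClosedLoopSolution U f r (predictor f k r l q) g μ x₀ w₀ (Ici 0) x w) :
    LoopBounds U f k r R μ (R * δ) (2 * Real.exp ((L + 1) * r) + 1 + R * C₁) (‖x₀‖ + ‖w₀‖) x w := by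
  set s₀ := ‖x₀‖ + ‖w₀‖ with hs₀
  have hr' : -r ≤ 0 := by linarith
  have hprojU : ∀ w, proj U w ∈ U := fun w => (proj_spec hU h0 w).1
  have hw : ContinuousOn w (Ici (-r)) := by
    have := h.continuousOn
    rwa [Icc_union_Ici_eq_Ici hr'] at this
  set u : ℝ → Vec m := fun s => proj U (w s) with hu
  have huU : ∀ t, u t ∈ U := fun t => hprojU _
  have huc : ContinuousOn u (Ici (-r)) := (continuous_proj hU hc h0).comp_continuousOn hw
  have hx : IsDelaySolution f r (Ici 0) u x := h.eq_x
  have hxc : ContinuousOn x (Ici 0) := fun t ht => (hx t ht).continuousWithinAt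
  have hFc : ContinuousOn (fun t => f (x t) (u (t - r))) (Ici 0) :=
    continuousOn_rhs hf hxc (huc.comp (by fun_prop) fun t ht => by
      have := mem_Ici.1 ht
      exact mem_Ici.2 (by linarith)) fun t _ => huU _
  have hw₀ : ∀ s (hs : s ∈ Icc (-r) 0), ‖w s‖ ≤ ‖w₀‖ := fun s hs => by
    rw [h.initial_w ⟨s, hs⟩]; exact w₀.norm_coe_le_norm _
  have hus : ∀ s ∈ Icc (-r) 0, ‖u s‖ ≤ ‖w₀‖ := fun s hs =>
    (norm_proj_le hU hc h0 _).trans (hw₀ s hs)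
  have huIcc : ∀ t, 0 ≤ t → ContinuousOn u (Icc (t - r) t) := fun t ht =>
    huc.mono fun s hs => mem_Ici.2 (by linarith [hs.1])
  have hhist : ∀ t, 0 ≤ t → ∀ θ, history r u t θ ∈ U := fun t ht θ => by
    rw [history_apply (huIcc t ht)]; exact huU _
  have hvc : ContinuousOn (fun t => w t - k (x (t + r))) (Ici 0) := by
    refine (hw.mono (Ici_subset_Ici.2 hr')).sub (hkc.comp_continuousOn (hxc.comp (by fun_prop) ?_))
    exact fun t ht => mem_Ici.2 (add_nonneg ht hr)
  have hshift : ∀ t₀ : ℝ, 0 ≤ t₀ → MapsTo (fun t => t + t₀) (Ici 0) (Ici 0) :=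
    fun t₀ ht₀ t ht => mem_Ici.2 (add_nonneg ht ht₀)
  have hknorm : ∀ y, ‖k y‖ ≤ R * ‖y‖ := fun y => by simpa [hk0] using hkR y 0
  refine ⟨fun t ht => ?_, hvc, fun t₀ ht₀ => ?_, fun t₀ ht₀ => ⟨?_, fun t ht => ?_⟩,
    fun t ht b hb => ?_, fun t _ => ?_⟩
  · have hx₀s : ‖x 0‖ ≤ s₀ := by rw [h.initial_x, hs₀]; linarith [norm_nonneg w₀]
    have hw₀s : ‖w₀‖ ≤ s₀ := by rw [hs₀]; linarith [norm_nonneg x₀]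
    refine (hx.norm_le hL hfGrowth huU hx₀s (fun s hs => (hus s hs).trans hw₀s) ht).trans ?_
    gcongr
    have : 0 ≤ R * C₁ := by positivity
    linarith
  · exact isInput_of_continuousOn (hvc.comp (by fun_prop) (hshift t₀ ht₀))
  · refine hxc.comp (by fun_prop) fun t ht => mem_Ici.2 (add_nonneg (add_nonneg ht ht₀) hr)
  -- The delayed input at time `t₀ + r + s` is `Pr_U (w (s + t₀))`, and adding `k` to the
  -- perturbation gives back `w`.
  · have h1 := eq_add_integral_of_hasDerivWithinAt hx hFc (add_nonneg ht₀ hr) ht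
    simp only
    rw [show t + t₀ + r = t₀ + r + t by ring, zero_add, h1]
    congr 2
    ext1 s
    rw [show t₀ + r + s - r = s + t₀ by ring, show t₀ + r + s = s + t₀ + r by ring,
      add_sub_cancel]
  -- The derivative of the predictor is `g`, which cancels in the equation for `w`.
  · have he : ∀ t, 0 ≤ t → HasDerivWithinAt
        (fun t => w t - predictor f k r l q (x t) (history r u t))
        (-(μ • (w t - predictor f k r l q (x t) (history r u t)))) (Ici 0) t := by
      intro t ht
      have h1 := hg.deriv u x huc (fun s _ => huU s) hx t ht
      refine ((h.eq_w t ht).sub h1).congr_deriv ?_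
      abel
    have h1 := eq_exp_smul_of_hasDerivWithinAt he ht
    set e₀ := w 0 - predictor f k r l q (x 0) (history r u 0) with he₀
    have he₀le : ‖e₀‖ ≤ (1 + R * C₁) * s₀ := by
      have h2 := hP (delayShift (history r u 0)) (x 0) ‖w₀‖ (norm_nonneg _)
        (delayShift_mem h0 (hhist 0 le_rfl)) fun s =>
          (norm_delayShift_le _ _).trans (norm_history_le (norm_nonneg _) (huIcc 0 le_rfl)
            (by simpa using hus))
      have h3 := (hknorm _).trans (mul_le_mul_of_nonneg_left h2 hR)
      have h4 := hw₀ 0 ⟨hr', le_rfl⟩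
      rw [h.initial_x] at h3
      have h5 := norm_sub_le (w 0) (predictor f k r l q (x 0) (history r u 0))
      rw [h.initial_x] at h5
      have h6 : ‖predictor f k r l q x₀ (history r u 0)‖ ≤ R * (C₁ * s₀) := h3
      have : ‖w₀‖ ≤ s₀ := by rw [hs₀]; linarith [norm_nonneg x₀]
      rw [he₀, h.initial_x]
      linarith
    have hpred : ‖predictor f k r l q (x t) (history r u t) - k (x (t + r))‖ ≤ R * (δ * b) := by
      refine (hkR _ _).trans (mul_le_mul_of_nonneg_left ?_ hR)
      have hmaps : MapsTo (fun τ => t + τ) (Icc 0 r) (Ici 0) := fun τ hτ =>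
        mem_Ici.2 (add_nonneg ht hτ.1)
      -- The exact solution over one delay, driven by the stored input, is `x` itself on `[t, t +
      -- r]`.
      have h2 := hPx (delayShift (history r u t)) (fun τ => x (t + τ)) b
        (continuousOn_delayShift hr _) (delayShift_mem h0 (hhist t ht))
        (hxc.comp (by fun_prop) hmaps) (fun τ hτ => by
          have h3 := eq_add_integral_of_hasDerivWithinAt hx hFc ht hτ.1
          rw [h3, add_zero]
          congr 1
          refine intervalIntegral.integral_congr fun σ hσ => ?_
          rw [uIcc_of_le hτ.1] at hσ
          rw [delayShift_of_mem _ ⟨hσ.1, hσ.2.trans hτ.2⟩, history_apply (huIcc t ht)]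
          congr 2
          ring)
        (fun τ hτ => hb _ ⟨by linarith [hτ.1], by linarith [hτ.2]⟩)
      simpa only [add_zero] using h2
    have hsplit : w t - k (x (t + r)) =
        (predictor f k r l q (x t) (history r u t) - k (x (t + r))) +
          Real.exp (-μ * t) • e₀ := by
      rw [← h1]; abel
    rw [hsplit]
    refine (norm_add_le _ _).trans ?_
    rw [norm_smul, Real.norm_eq_abs, Real.abs_exp]
    have h2 := mul_le_mul_of_nonneg_left he₀le (Real.exp_pos (-μ * t)).le
    have h3 : (1 + R * C₁) * s₀ ≤ (2 * Real.exp ((L + 1) * r) + 1 + R * C₁) * s₀ := by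
      have : 0 ≤ s₀ := by positivity
      gcongr
      linarith [Real.exp_pos ((L + 1) * r)]
    have h4 := mul_le_mul_of_nonneg_left h3 (Real.exp_pos (-μ * t)).le
    linarith
  · have h1 : w t = (w t - k (x (t + r))) + k (x (t + r)) := by abel
    calc ‖w t‖ = ‖(w t - k (x (t + r))) + k (x (t + r))‖ := by rw [← h1]
      _ ≤ _ := (norm_add_le _ _).trans (add_le_add le_rfl (hknorm _))

end LoopBounds

/-! ### Bounds and decay of closed-loop solutions -/

section Decay

variable {n m : ℕ} {U : Set (Vec m)} {f : Vec n → Vec m → Vec n} {k : Vec n → Vec m} {r : ℝ}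
  {R μ δ C s₀ : ℝ} {x : ℝ → Vec n} {w : ℝ → Vec m}

theorem IsKL.nonneg {σ : ℝ → ℝ → ℝ} (hσ : IsKL σ) {s t : ℝ} (hs : 0 ≤ s) (ht : 0 ≤ t) :
    0 ≤ σ s t := by
  rw [← hσ.zero t ht]
  exact (hσ.strictMonoOn t ht).monotoneOn self_mem_Ici hs hs

theorem LoopBounds.v_le_shifted (h : LoopBounds U f k r R μ δ C s₀ x w) {t : ℝ} (ht : 0 ≤ t) {b : ℝ}
    (hb : ∀ s ∈ Icc (t - r) t, ‖x (s + r)‖ ≤ b) :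
    ‖w t - k (x (t + r))‖ ≤ δ * b + C * s₀ * Real.exp (-μ * t) :=
  h.v_le t ht b fun s hs => by
    have := hb (s - r) ⟨by linarith [hs.1], by linarith [hs.2]⟩
    rwa [sub_add_cancel] at this

theorem LoopBounds.weighted_bound (h : LoopBounds U f k r R μ δ C s₀ x w)
    (hC : 0 ≤ C) (hs₀ : 0 ≤ s₀) {ω A γ : ℝ} (hω : 0 ≤ ω) (hωμ : ω ≤ μ) (hA : 0 ≤ A) (hγ : 0 ≤ γ)
    (hgain : ∀ t, 0 ≤ t → ∀ b,
      (∀ τ ∈ Icc 0 t, Real.exp (ω * τ) * ‖w τ - k (x (τ + r))‖ ≤ b) →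
      Real.exp (ω * t) * ‖x (t + r)‖ ≤ A + γ * b)
    (hδγ : δ * Real.exp (ω * r) * γ ≤ 1 / 2) (hδ : δ * Real.exp (ω * r) ≤ 1) {t : ℝ}
    (ht : 0 ≤ t) :
    Real.exp (ω * t) * ‖w t - k (x (t + r))‖ ≤ 2 * (2 * C * s₀ + A) ∧
      Real.exp (ω * t) * ‖x (t + r)‖ ≤ A + γ * (2 * (2 * C * s₀ + A)) := by
  have hCs : 0 ≤ C * s₀ := mul_nonneg hC hs₀
  have e : C * s₀ + A + C * s₀ = 2 * C * s₀ + A := by ring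
  rw [← e]
  refine weighted_small_gain (a := fun t => ‖x (t + r)‖) (c := fun t => ‖w t - k (x (t + r))‖)
    hω hA hCs hγ (fun t _ => norm_nonneg _) h.continuousOn_v.norm
    (fun s hs => h.x_le _ ⟨by linarith [hs.1], by linarith [hs.2]⟩) hgain
    (fun t ht b hb => ?_) hδγ hδ ht
  have h1 := mul_le_mul_of_nonneg_left (h.v_le_shifted ht hb) (Real.exp_pos (ω * t)).le
  have h2 : Real.exp (ω * t) * Real.exp (-μ * t) ≤ 1 := by
    rw [← Real.exp_add]
    exact Real.exp_le_one_iff.2 (by nlinarith)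
  have h3 := mul_le_mul_of_nonneg_left h2 hCs
  linarith

theorem LoopBounds.add_norm_le (h : LoopBounds U f k r R μ δ C s₀ x w)
    (hC : 0 ≤ C) (hs₀ : 0 ≤ s₀) (hR : 0 ≤ R) {ω V Z : ℝ} (hω : 0 ≤ ω) (hZ : 0 ≤ Z)
    (hVZ : ∀ t, 0 ≤ t → Real.exp (ω * t) * ‖w t - k (x (t + r))‖ ≤ V ∧
      Real.exp (ω * t) * ‖x (t + r)‖ ≤ Z) {t : ℝ} (ht : 0 ≤ t) :
    Real.exp (ω * t) * (‖x t‖ + ‖w t‖) ≤ Real.exp (ω * r) * (C * s₀ + Z) + (V + R * Z) := by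
  have hCs : 0 ≤ C * s₀ := mul_nonneg hC hs₀
  have h1 : Real.exp (ω * t) * ‖x t‖ ≤ Real.exp (ω * r) * (C * s₀ + Z) := by
    rcases le_total t r with htr | htr
    · have h2 := h.x_le t ⟨ht, htr⟩
      have h3 : Real.exp (ω * t) ≤ Real.exp (ω * r) :=
        Real.exp_le_exp.2 (mul_le_mul_of_nonneg_left htr hω)
      exact mul_le_mul h3 (by linarith) (norm_nonneg _) (Real.exp_pos _).le
    · have h2 := (hVZ (t - r) (by linarith)).2
      rw [sub_add_cancel] at h2
      have e : Real.exp (ω * t) = Real.exp (ω * r) * Real.exp (ω * (t - r)) := by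
        rw [← Real.exp_add]; congr 1; ring
      rw [e, mul_assoc]
      exact mul_le_mul_of_nonneg_left (by linarith) (Real.exp_pos _).le
  have h2 := mul_le_mul_of_nonneg_left (h.w_le t ht) (Real.exp_pos (ω * t)).le
  obtain ⟨h3, h4⟩ := hVZ t ht
  have h5 := mul_le_mul_of_nonneg_left h4 hR
  linarith

/-- The delay-free system is autonomous, so the ISS estimate can be restarted at any `t₀`;
`uniform_decay` relies on this. -/
theorem LoopBounds.iss (h : LoopBounds U f k r R μ δ C s₀ x w) {σ : ℝ → ℝ → ℝ} {γ : ℝ}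
    (hiss : LinearGainISS U f k σ γ) {t₀ : ℝ} (ht₀ : 0 ≤ t₀) {t : ℝ} (ht : t₀ ≤ t) {b : ℝ}
    (hb : ∀ τ ∈ Icc t₀ t, ‖w τ - k (x (τ + r))‖ ≤ b) :
    ‖x (t + r)‖ ≤ max (σ ‖x (t₀ + r)‖ (t - t₀)) (γ * b) := by
  have h1 := hiss _ _ (h.isInput t₀ ht₀) (h.perturbed t₀ ht₀) (t - t₀) (by linarith) b
    fun τ hτ => hb (τ + t₀) ⟨by linarith [hτ.1], by linarith [hτ.2]⟩
  simpa only [sub_add_cancel, zero_add] using h1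

theorem LoopBounds.iss_bound (h : LoopBounds U f k r R μ δ C s₀ x w) (hr : 0 ≤ r)
    (hC : 0 ≤ C) (hs₀ : 0 ≤ s₀) (hμ : 0 < μ) {σ : ℝ → ℝ → ℝ} {γ : ℝ} (hσ : IsKL σ)
    (hγ : 0 ≤ γ) (hiss : LinearGainISS U f k σ γ) (hδγ : δ * γ ≤ 1 / 2) (hδ : δ ≤ 1) {t : ℝ}
    (ht : 0 ≤ t) :
    ‖w t - k (x (t + r))‖ ≤ 2 * (2 * C * s₀ + σ (C * s₀) 0) ∧
      ‖x (t + r)‖ ≤ σ (C * s₀) 0 + γ * (2 * (2 * C * s₀ + σ (C * s₀) 0)) := by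
  have hCs : 0 ≤ C * s₀ := mul_nonneg hC hs₀
  have hA := hσ.nonneg hCs le_rfl
  have := h.weighted_bound hC hs₀ (ω := 0) (A := σ (C * s₀) 0) (γ := γ) le_rfl hμ.le hA hγ
    (fun t ht b hb => by
      simp only [zero_mul, Real.exp_zero, one_mul] at hb ⊢
      have h1 := h.iss hiss le_rfl ht hb
      have hb0 : 0 ≤ b := (norm_nonneg _).trans (hb 0 ⟨le_rfl, ht⟩)
      have h2 : σ ‖x (0 + r)‖ (t - 0) ≤ σ (C * s₀) 0 := by
        rw [sub_zero, zero_add]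
        exact (hσ.antitoneOn _ (norm_nonneg _) self_mem_Ici ht ht).trans
          ((hσ.strictMonoOn 0 le_rfl).monotoneOn (norm_nonneg _) hCs (h.x_le r ⟨hr, le_rfl⟩))
      refine h1.trans (max_le ?_ ?_)
      · linarith [mul_nonneg hγ hb0]
      · linarith)
    (by simpa using hδγ) (by simpa using hδ) ht
  simpa only [zero_mul, Real.exp_zero, one_mul] using this

theorem LoopBounds.exp_bound (h : LoopBounds U f k r R μ δ C s₀ x w) (hr : 0 ≤ r)
    (hC : 0 ≤ C) (hs₀ : 0 ≤ s₀) {M ω ν γ : ℝ} (hM : 0 ≤ M) (hν : 0 ≤ ν) (hνω : ν ≤ ω) (hνμ : ν ≤ μ)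
    (hγ : 0 ≤ γ) (hiss : ExpISS U f k M ω γ) (hδγ : δ * Real.exp (ω * r) * γ ≤ 1 / 2)
    (hδ : δ * Real.exp (ω * r) ≤ 1) (hδ0 : 0 ≤ δ) {t : ℝ} (ht : 0 ≤ t) :
    Real.exp (ν * t) * ‖w t - k (x (t + r))‖ ≤ 2 * (2 * C * s₀ + M * (C * s₀)) ∧
      Real.exp (ν * t) * ‖x (t + r)‖ ≤
        M * (C * s₀) + γ * (2 * (2 * C * s₀ + M * (C * s₀))) := by
  have hCs : 0 ≤ C * s₀ := mul_nonneg hC hs₀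
  have hexp : Real.exp (ν * r) ≤ Real.exp (ω * r) :=
    Real.exp_le_exp.2 (mul_le_mul_of_nonneg_right hνω hr)
  have hδexp := mul_le_mul_of_nonneg_left hexp hδ0
  refine h.weighted_bound hC hs₀ (ω := ν) (γ := γ) hν hνμ (mul_nonneg hM hCs) hγ
    (fun t ht b hb => ?_) ((mul_le_mul_of_nonneg_right hδexp hγ).trans hδγ) (hδexp.trans hδ) ht
  have hb0 : 0 ≤ b := (mul_nonneg (Real.exp_pos _).le (norm_nonneg _)).trans (hb 0 ⟨le_rfl, ht⟩)
  -- The kernel `exp (-ω (t - τ))` is dominated by the slower `exp (-ν (t - τ))`, which turns the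
  -- bound `b` on the weighted perturbation into `exp (-(ν t)) * b`.
  have h1 := hiss _ _ (h.isInput 0 le_rfl) (h.perturbed 0 le_rfl) t ht (Real.exp (-(ν * t)) * b)
    (fun τ hτ => by
      simp only [add_zero]
      have h2 := mul_le_mul_of_nonneg_left (hb τ hτ) (Real.exp_pos (-(ν * t))).le
      refine le_trans ?_ h2
      rw [← mul_assoc, ← Real.exp_add]
      refine mul_le_mul_of_nonneg_right (Real.exp_le_exp.2 ?_) (norm_nonneg _)
      have := mul_le_mul_of_nonneg_right hνω (sub_nonneg.2 hτ.2)
      linarith)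
  simp only [add_zero, zero_add] at h1
  have h2 := mul_le_mul_of_nonneg_left h1 (Real.exp_pos (ν * t)).le
  refine h2.trans ?_
  rw [mul_max_of_nonneg _ _ (Real.exp_pos _).le]
  refine max_le ?_ ?_
  · have h3 : Real.exp (ν * t) * Real.exp (-ω * t) ≤ 1 := by
      rw [← Real.exp_add]
      exact Real.exp_le_one_iff.2 (by nlinarith)
    have h4 := mul_le_mul_of_nonneg_left (h.x_le r ⟨hr, le_rfl⟩) hM
    have h5 := mul_le_mul_of_nonneg_right h3 (mul_nonneg hM (norm_nonneg (x r)))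
    have := mul_nonneg hγ hb0
    linarith
  · have h3 : Real.exp (ν * t) * Real.exp (-(ν * t)) = 1 := by
      rw [← Real.exp_add]; simp
    have e : Real.exp (ν * t) * (γ * (Real.exp (-(ν * t)) * b)) =
        Real.exp (ν * t) * Real.exp (-(ν * t)) * (γ * b) := by ring
    rw [e, h3, one_mul]
    have := mul_nonneg hM hCs
    linarith

theorem exists_time_iss_le {σ : ℝ → ℝ → ℝ} {γ : ℝ} (hσ : IsKL σ)
    (hγ : 0 ≤ γ) (hiss : LinearGainISS U f k σ γ) (hr : 0 ≤ r) (hR : 0 ≤ R) (hμ : 0 < μ)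
    (hC : 0 ≤ C) (hδγ : δ * γ ≤ 1 / 4) (hδ : δ ≤ 1) (S η : ℝ) (hη : 0 < η) :
    ∃ T : ℝ, ∀ (s₀ : ℝ) (x : ℝ → Vec n) (w : ℝ → Vec m), 0 ≤ s₀ → s₀ ≤ S →
      LoopBounds U f k r R μ δ C s₀ x w → ∀ t, T ≤ t → ‖x t‖ + ‖w t‖ ≤ η := by
  rcases lt_or_ge S 0 with hS | hS
  · exact ⟨0, fun s₀ _ _ h1 h2 => absurd (h1.trans h2) (not_le.2 hS)⟩
  have hCS : 0 ≤ C * S := mul_nonneg hC hS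
  have hA := hσ.nonneg hCS le_rfl
  set B := σ (C * S) 0 + γ * (2 * (2 * C * S + σ (C * S) 0)) + 1 with hB
  have hB0 : 0 < B := by positivity
  -- The factor `2 + R` collects one `B / 2 ^ N` from `x` and, for `w`, at most `1 + R` from `v` and
  -- from `k (x (t + r))`; the exponential remainder takes the other half of `η`.
  obtain ⟨N, hN⟩ : ∃ N : ℕ, B / 2 ^ N * (2 + R) ≤ η / 2 := by
    have h1 : Tendsto (fun N : ℕ => B / 2 ^ N * (2 + R)) atTop (𝓝 0) := by
      have := (tendsto_pow_atTop_nhds_zero_of_lt_one (r := (1 / 2 : ℝ)) (by norm_num)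
        (by norm_num)).const_mul (B * (2 + R))
      rw [mul_zero] at this
      refine this.congr fun N => ?_
      rw [div_pow, one_pow]
      ring
    exact (h1.eventually (eventually_le_nhds (by positivity))).exists
  obtain ⟨T₁, hT₁0, hT₁⟩ := uniform_decay hσ hr hμ hδγ hB0 hCS N
  obtain ⟨T₂, hT₂⟩ : ∃ T₂, ∀ t ≥ T₂, C * S * Real.exp (-μ * t) ≤ η / 2 := by
    have h1 : Tendsto (fun t : ℝ => Real.exp (-μ * t)) atTop (𝓝 0) :=
      Real.tendsto_exp_atBot.comp (tendsto_id.const_mul_atTop_of_neg (neg_lt_zero.2 hμ))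
    have h2 := h1.const_mul (C * S)
    rw [mul_zero] at h2
    exact eventually_atTop.1 (h2.eventually (eventually_le_nhds (by positivity)))
  refine ⟨max (T₁ + r) T₂, fun s₀ x w hs₀ hs₀S h t ht => ?_⟩
  have ht1 : T₁ + r ≤ t := (le_max_left _ _).trans ht
  have ht0 : 0 ≤ t := by linarith
  have hCsS : C * s₀ ≤ C * S := mul_le_mul_of_nonneg_left hs₀S hC
  have hsmall := hT₁ (fun t => ‖x (t + r)‖) (fun t => ‖w t - k (x (t + r))‖)
    (fun t _ => norm_nonneg _) (fun t ht => by
      have h1 := (h.iss_bound hr hC hs₀ hμ hσ hγ hiss (by linarith) hδ ht).2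
      have h2 : σ (C * s₀) 0 ≤ σ (C * S) 0 :=
        (hσ.strictMonoOn 0 le_rfl).monotoneOn (mem_Ici.2 (mul_nonneg hC hs₀)) hCS hCsS
      have h3 := mul_le_mul_of_nonneg_left hCsS hγ
      have h4 := mul_le_mul_of_nonneg_left h2 hγ
      rw [hB]
      linarith)
    (fun t₀ ht₀ t ht b hb => h.iss hiss ht₀ ht hb)
    (fun t ht b hb => (h.v_le_shifted ht hb).trans (by gcongr))
  have hx : ‖x t‖ ≤ B / 2 ^ N := by
    have := hsmall (t - r) (by linarith)
    simpa only [sub_add_cancel] using this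
  have hz := hsmall t (by linarith)
  have hv := h.v_le_shifted ht0 (b := B / 2 ^ N) fun s hs => hsmall s (by linarith [hs.1])
  have hE : C * s₀ * Real.exp (-μ * t) ≤ C * S * Real.exp (-μ * t) := by gcongr
  have hw := h.w_le t ht0
  have h1 := mul_le_mul_of_nonneg_left hz hR
  have h2 := hT₂ t ((le_max_right _ _).trans ht)
  have h3 : δ * (B / 2 ^ N) ≤ B / 2 ^ N := mul_le_of_le_one_left (by positivity) hδ
  linarith

end Decay

/-! ### The closed-loop estimates -/

section ClosedLoopEstimate

variable {n m : ℕ} {U : Set (Vec m)} {f : Vec n → Vec m → Vec n} {k : Vec n → Vec m} {r : ℝ}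
  {R μ δ C : ℝ} {p g : Vec n → Hist r m → Vec m}

theorem exists_isKL_closedLoopEstimate {σ : ℝ → ℝ → ℝ} {γ : ℝ} (hσ : IsKL σ)
    (hγ : 0 ≤ γ) (hiss : LinearGainISS U f k σ γ) (hr : 0 ≤ r) (hR : 0 ≤ R) (hμ : 0 < μ)
    (hC : 0 ≤ C) (hδγ : δ * γ ≤ 1 / 4) (hδ : δ ≤ 1)
    (hex : ∀ (x₀ : Vec n) (w₀ : Hist r m), ∃ (x : ℝ → Vec n) (w : ℝ → Vec m),
      IsClosedLoopSolution U f r p g μ x₀ w₀ (Ici 0) x w ∧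
      ∀ a : ℝ, 0 < a → ∀ (y : ℝ → Vec n) (z : ℝ → Vec m),
        IsClosedLoopSolution U f r p g μ x₀ w₀ (Ico 0 a) y z →
          EqOn y x (Ico 0 a) ∧ EqOn z w (Ico 0 a))
    (hbd : ∀ (x₀ : Vec n) (w₀ : Hist r m) (x : ℝ → Vec n) (w : ℝ → Vec m),
      IsClosedLoopSolution U f r p g μ x₀ w₀ (Ici 0) x w →
        LoopBounds U f k r R μ δ C (‖x₀‖ + ‖w₀‖) x w) :
    ∃ β : ℝ → ℝ → ℝ, IsKL β ∧ ClosedLoopEstimate U f r p g μ β := by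
  -- The data for the `KL` majorant: all solutions from all initial conditions, evaluated at all
  -- times.
  let ι := {i : (Vec n × Hist r m) × ((ℝ → Vec n) × (ℝ → Vec m)) × ℝ //
    IsClosedLoopSolution U f r p g μ i.1.1 i.1.2 (Ici 0) i.2.1.1 i.2.1.2 ∧ 0 ≤ i.2.2}
  -- This is the bound of `LoopBounds.add_norm_le` with `ω = 0`, fed with the constants of
  -- `LoopBounds.iss_bound`.
  let α : ℝ → ℝ := fun s => C * s + (σ (C * s) 0 + γ * (2 * (2 * C * s + σ (C * s) 0))) +
    (2 * (2 * C * s + σ (C * s) 0) + R * (σ (C * s) 0 + γ * (2 * (2 * C * s + σ (C * s) 0))))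
  have hσmono : MonotoneOn (fun s => σ (C * s) 0) (Ici 0) := fun s hs s' hs' hss =>
    (hσ.strictMonoOn 0 le_rfl).monotoneOn (mem_Ici.2 (mul_nonneg hC hs))
      (mem_Ici.2 (mul_nonneg hC hs')) (mul_le_mul_of_nonneg_left hss hC)
  have hσcont : ContinuousOn (fun s => σ (C * s) 0) (Ici 0) :=
    hσ.continuousOn.comp (f := fun s : ℝ => (C * s, (0 : ℝ))) (by fun_prop) fun s hs =>
      ⟨mem_Ici.2 (mul_nonneg hC hs), self_mem_Ici⟩
  obtain ⟨β, hβ, hle⟩ := exists_isKL_majorant (ι := ι) (α := α)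
    (a := fun i => ‖i.1.1.1‖ + ‖i.1.1.2‖) (θ := fun i => i.1.2.2)
    (y := fun i => ‖i.1.2.1.1 i.1.2.2‖ + ‖i.1.2.1.2 i.1.2.2‖)
    (fun s hs s' hs' hss => by
      have h1 := hσmono hs hs' hss
      simp only [α]
      simp only at h1
      gcongr)
    (by simp [α, hσ.zero 0 le_rfl])
    (by
      have hlin : ∀ c : ℝ, ContinuousOn (fun s : ℝ => c * s) (Ici 0) := fun c =>
        (continuous_const_mul c).continuousOn
      have hsum := ((hlin (2 * C)).add hσcont).const_mul 2
      exact ((hlin C).add (hσcont.add (hsum.const_mul γ))).add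
        (hsum.add ((hσcont.add (hsum.const_mul γ)).const_mul R)))
    (fun i => by positivity) (fun i => by positivity)
    (fun i => by
      have hs₀ : 0 ≤ ‖i.1.1.1‖ + ‖i.1.1.2‖ := by positivity
      have h := hbd _ _ _ _ i.2.1
      have h1 := fun t ht => h.iss_bound hr hC hs₀ hμ hσ hγ hiss (by linarith) hδ (t := t) ht
      have h2 := h.add_norm_le (ω := 0) hC hs₀ hR le_rfl
        ((norm_nonneg _).trans (h1 0 le_rfl).2) (fun t ht => by
          simpa only [zero_mul, Real.exp_zero, one_mul] using h1 t ht) i.2.2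
      simpa only [zero_mul, Real.exp_zero, one_mul] using h2)
    (fun S η hη => by
      obtain ⟨T, hT⟩ := exists_time_iss_le (n := n) (m := m) hσ hγ hiss hr hR hμ hC hδγ hδ S η hη
      exact ⟨T, fun i hiS hiT => hT _ _ _ (by positivity) hiS (hbd _ _ _ _ i.2.1) _ hiT⟩)
  refine ⟨β, hβ, fun x₀ w₀ => ?_⟩
  obtain ⟨x, w, hsol, huniq⟩ := hex x₀ w₀
  exact ⟨x, w, hsol, huniq, fun t ht => hle ⟨((x₀, w₀), (x, w), t), hsol, ht⟩⟩

theorem exists_exp_closedLoopEstimate {M ω γ : ℝ} (hM : 0 < M) (hω : 0 < ω)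
    (hγ : 0 ≤ γ) (hiss : ExpISS U f k M ω γ) (hr : 0 ≤ r) (hR : 0 ≤ R) (hμ : 0 < μ)
    (hC : 0 ≤ C) (hδγ : δ * Real.exp (ω * r) * γ ≤ 1 / 2) (hδ : δ * Real.exp (ω * r) ≤ 1)
    (hδ0 : 0 ≤ δ)
    (hex : ∀ (x₀ : Vec n) (w₀ : Hist r m), ∃ (x : ℝ → Vec n) (w : ℝ → Vec m),
      IsClosedLoopSolution U f r p g μ x₀ w₀ (Ici 0) x w ∧
      ∀ a : ℝ, 0 < a → ∀ (y : ℝ → Vec n) (z : ℝ → Vec m),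
        IsClosedLoopSolution U f r p g μ x₀ w₀ (Ico 0 a) y z →
          EqOn y x (Ico 0 a) ∧ EqOn z w (Ico 0 a))
    (hbd : ∀ (x₀ : Vec n) (w₀ : Hist r m) (x : ℝ → Vec n) (w : ℝ → Vec m),
      IsClosedLoopSolution U f r p g μ x₀ w₀ (Ici 0) x w →
        LoopBounds U f k r R μ δ C (‖x₀‖ + ‖w₀‖) x w) :
    ∃ M' ω' : ℝ, 0 < M' ∧ 0 < ω' ∧
      ClosedLoopEstimate U f r p g μ (fun s t => M' * Real.exp (-ω' * t) * s) := by
  -- Neither the ISS rate nor the decay of `w - p` can be exceeded.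
  set ν := min ω μ with hν
  have hν0 : 0 < ν := lt_min hω hμ
  set V := 2 * (2 * C + M * C) with hV
  set Z := M * C + γ * V with hZ
  have hV0 : 0 ≤ V := by positivity
  have hZ0 : 0 ≤ Z := by positivity
  refine ⟨Real.exp (ν * r) * (C + Z) + (V + R * Z) + 1, ν, by positivity, hν0, fun x₀ w₀ => ?_⟩
  obtain ⟨x, w, hsol, huniq⟩ := hex x₀ w₀
  refine ⟨x, w, hsol, huniq, fun t ht => ?_⟩
  have hs₀ : 0 ≤ ‖x₀‖ + ‖w₀‖ := by positivity
  set s₀ := ‖x₀‖ + ‖w₀‖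
  have h := hbd _ _ _ _ hsol
  have h1 := h.add_norm_le (ω := ν) (V := V * s₀) (Z := Z * s₀) hC hs₀ hR hν0.le (by positivity)
    (fun t ht => by
      have h2 := h.exp_bound hr hC hs₀ hM.le hν0.le (min_le_left _ _) (min_le_right _ _) hγ hiss
        hδγ hδ hδ0 ht
      have e : 2 * (2 * C * s₀ + M * (C * s₀)) = V * s₀ := by rw [hV]; ring
      rw [e] at h2
      refine ⟨h2.1, h2.2.trans (le_of_eq ?_)⟩
      rw [hZ]; ring) ht
  have h2 := mul_le_mul_of_nonneg_left h1 (Real.exp_pos (-ν * t)).le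
  have h3 : Real.exp (-ν * t) * Real.exp (ν * t) = 1 := by
    rw [← Real.exp_add]; simp
  rw [← mul_assoc, h3, one_mul] at h2
  have h4 : 0 ≤ Real.exp (-ν * t) * s₀ := by positivity
  simp only
  linarith

end ClosedLoopEstimate

end ApproxPredictor

/-! ### Choice of the number of iterations -/

open ApproxPredictor
theorem corollary3p4 (n m : ℕ) (r : ℝ) (hr : 0 ≤ r)
    (U : Set (Vec m)) (hUclosed : IsClosed U) (hUconvex : Convex ℝ U) (hU0 : (0 : Vec m) ∈ U)
    (f : Vec n → Vec m → Vec n)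
    (hf : LocallyLipschitzOn (Set.univ ×ˢ U) (fun z : Vec n × Vec m => f z.1 z.2))
    (L : ℝ) (hL : 0 ≤ L)
    (hfLip : ∀ x y : Vec n, ∀ u ∈ U, ‖f x u - f y u‖ ≤ L * ‖x - y‖)
    (hfGrowth : ∀ x : Vec n, ∀ u ∈ U, ‖f x u‖ ≤ L * ‖x‖ + L * ‖u‖)
    (k : Vec n → Vec m) (hk : ContDiff ℝ 1 k) (hkU : ∀ x, k x ∈ U) (hk0 : k 0 = 0)
    (R : ℝ) (hR : 0 ≤ R) (hkR : ∀ x, ‖fderiv ℝ k x‖ ≤ R)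
    (q : ℕ) (hq : 0 < q) (hLrq : L * r < q) :
    (∀ (σ : ℝ → ℝ → ℝ) (γ : ℝ), IsKL σ → 0 ≤ γ → LinearGainISS U f k σ γ →
      ∃ l₀ : ℕ, 1 ≤ l₀ ∧ ∀ l : ℕ, l₀ ≤ l →
        ∀ g : Vec n → Hist r m → Vec m, IsDerivativePair U f r (predictor f k r l q) g →
          ∀ μ : ℝ, 0 < μ → ∃ β : ℝ → ℝ → ℝ, IsKL β ∧
            ClosedLoopEstimate U f r (predictor f k r l q) g μ β) ∧
    (∀ M ω γ : ℝ, 0 < M → 0 < ω → 0 ≤ γ → ExpISS U f k M ω γ →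
      ∃ l₀ : ℕ, 1 ≤ l₀ ∧ ∀ l : ℕ, l₀ ≤ l →
        ∀ g : Vec n → Hist r m → Vec m, IsDerivativePair U f r (predictor f k r l q) g →
          ∀ μ : ℝ, 0 < μ → ∃ M' ω' : ℝ, 0 < M' ∧ 0 < ω' ∧
            ClosedLoopEstimate U f r (predictor f k r l q) g μ
              (fun s t => M' * Real.exp (-ω' * t) * s)) := by
  have hfc := hf.continuousOn
  have hkLip : ∀ x y, ‖k x - k y‖ ≤ R * ‖x - y‖ := fun x y =>
    convex_univ.norm_image_sub_le_of_norm_fderiv_le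
      (fun z _ => (hk.differentiable one_ne_zero).differentiableAt) (fun z _ => hkR z)
      (mem_univ y) (mem_univ x)
  obtain ⟨C₁, hC₁, hP⟩ := norm_flowApprox_le (m := m) (U := U) hL hr hq hLrq hfGrowth
  obtain ⟨ε, hε, hε0, hPx⟩ := norm_flowApprox_sub_le hL hr hq hLrq hfc hfLip
  set C := 2 * Real.exp ((L + 1) * r) + 1 + R * C₁ with hC
  have hC0 : 0 ≤ C := by positivity
  have hbd : ∀ l g, IsDerivativePair U f r (predictor f k r l q) g → ∀ μ : ℝ,
      ∀ (x₀ : Vec n) (w₀ : Hist r m) (x : ℝ → Vec n) (w : ℝ → Vec m),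
      IsClosedLoopSolution U f r (predictor f k r l q) g μ x₀ w₀ (Ici 0) x w →
        LoopBounds U f k r R μ (R * ε l) C (‖x₀‖ + ‖w₀‖) x w :=
    fun l g hg μ x₀ w₀ x w h => h.loopBounds hr hUclosed hUconvex hU0 hfc hL hfGrowth hR
      hk.continuous hkLip hk0 hC₁ (hP l) (hPx l) hg
  have hex : ∀ l g, IsDerivativePair U f r (predictor f k r l q) g → ∀ (μ : ℝ)
      (x₀ : Vec n) (w₀ : Hist r m), ∃ (x : ℝ → Vec n) (w : ℝ → Vec m),
      IsClosedLoopSolution U f r (predictor f k r l q) g μ x₀ w₀ (Ici 0) x w ∧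
      ∀ a : ℝ, 0 < a → ∀ (y : ℝ → Vec n) (z : ℝ → Vec m),
        IsClosedLoopSolution U f r (predictor f k r l q) g μ x₀ w₀ (Ico 0 a) y z →
          EqOn y x (Ico 0 a) ∧ EqOn z w (Ico 0 a) := by
    intro l g hg μ x₀ w₀
    obtain ⟨G, hG, hgG⟩ := hg.growth
    refine exists_unique_closedLoopSolution hUclosed hUconvex hU0 hf hL hfGrowth hg.lipschitz_p
      hg.lipschitz_g (G := max G (R * C₁)) (le_max_of_le_left hG) (fun x φ hφ => ?_)
      (fun x φ hφ => (hgG x φ hφ).trans (by gcongr <;> exact le_max_left _ _)) hr x₀ w₀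
    have h1 := hP l (delayShift φ) x ‖φ‖ (norm_nonneg _) (delayShift_mem hU0 hφ)
      (norm_delayShift_le φ)
    have h2 := hkLip (flowApprox f r l q (delayShift φ) x) 0
    rw [hk0, sub_zero, sub_zero] at h2
    calc ‖predictor f k r l q x φ‖ ≤ R * (C₁ * (‖x‖ + ‖φ‖)) :=
          h2.trans (mul_le_mul_of_nonneg_left h1 hR)
      _ = R * C₁ * ‖x‖ + R * C₁ * ‖φ‖ := by ring
      _ ≤ _ := by gcongr <;> exact le_max_right _ _
  have hsmall : ∀ a η : ℝ, 0 < η → ∀ᶠ l in atTop, R * ε l * a ≤ η := fun a η hη => by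
    have := (hε.const_mul R).mul_const a
    rw [mul_zero, zero_mul] at this
    exact this.eventually (eventually_le_nhds hη)
  refine ⟨fun σ γ hσ hγ hiss => ?_, fun M ω γ hM hω hγ hiss => ?_⟩
  · obtain ⟨l₀, hl₀⟩ := eventually_atTop.1
      ((hsmall γ (1 / 4) (by norm_num)).and (hsmall 1 1 one_pos))
    refine ⟨max 1 l₀, le_max_left _ _, fun l hl g hg μ hμ => ?_⟩
    obtain ⟨h1, h2⟩ := hl₀ l ((le_max_right _ _).trans hl)
    exact exists_isKL_closedLoopEstimate hσ hγ hiss hr hR hμ hC0 h1 (by rwa [mul_one] at h2)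
      (hex l g hg μ) (hbd l g hg μ)
  -- The smallness conditions involve `ω` and not `min ω μ`, so `l₀` is fixed before `μ` and `g`;
  -- the smaller rate only weakens them.
  · obtain ⟨l₀, hl₀⟩ := eventually_atTop.1
      ((hsmall (Real.exp (ω * r) * γ) (1 / 2) (by norm_num)).and
        (hsmall (Real.exp (ω * r)) 1 one_pos))
    refine ⟨max 1 l₀, le_max_left _ _, fun l hl g hg μ hμ => ?_⟩
    obtain ⟨h1, h2⟩ := hl₀ l ((le_max_right _ _).trans hl)
    exact exists_exp_closedLoopEstimate hM hω hγ hiss hr hR hμ hC0 (by rwa [← mul_assoc] at h1) h2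
      (mul_nonneg hR (hε0 l)) (hex l g hg μ) (hbd l g hg μ)
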